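/- Let $R$ be a commutative Noetherian local ring with residue field $k$; all modules are finitely generated. Write $\operatorname{depth}X=\inf\{i:\operatorname{Ext}^i_R(k,X)\neq0\}$ (so $\operatorname{depth}0=\infty$). For a projective presentation $P_1\xrightarrow{f}P_0\to X\to0$ put $\operatorname{Tr}X=\operatorname{coker}(\operatorname{Hom}(f,R))$, and for $n\ge1$ put $\mathcal T_{n}X=\operatorname{Tr}\Omega^{n-1}X$, where $\Omega^{n-1}X$ is an $(n-1)$st syzygy of $X$ (any choice of projective presentations and syzygies is allowed). $\operatorname{pd}$ is projective dimension and $\operatorname{G\text{-}dim}$ is Gorenstein dimension, i.e. the least length of a resolution by totally reflexive modules ($X$ is totally reflexive if $X\to X^{**}$ is bijective and $\operatorname{Ext}^i_R(X,R)=0=\operatorname{Ext}^i_R(X^*,R)$ for all $i\ge1$); all dimensions of $0$ are $-\infty$. A module $N$ is *Tor-rigid* if for all modules $X$ and all $n\ge1$, $\operatorname{Tor}_n^R(N,X)=0$ implies $\operatorname{Tor}_{n+1}^R(N,X)=0$. It is *strongly-rigid* if for all modules $X$, $\operatorname{Tor}_n^R(N,X)=0$ for some $n\ge1$ implies $\operatorname{pd}X<\infty$.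 A module $M$ satisfies $(\widetilde S_r)$ if $\operatorname{depth}_{R_{\mathfrak p}}M_{\mathfrak p}\ge\min\{r,\operatorname{depth}R_{\mathfrak p}\}$ for all $\mathfrak p\in\operatorname{Supp}M$. A *homological dimension* $\mathsf H\text{-}\dim$ assigns to each module a value in $\{-\infty\}\cup\mathbb N\cup\{\infty\}$, depends only on the isomorphism class, and satisfies: (a) $\operatorname{G\text{-}dim}X\le\mathsf H\text{-}\dim X\le\operatorname{pd}X$ for all $X$; (b) if $\mathsf H\text{-}\dim X=0$, then $\operatorname{Tr}X=0$ or $\mathsf H\text{-}\dim(\operatorname{Tr}X)=0$; (c) for every exact sequence $0\to X'\to P\to X\to0$ with $P$ projective and every integer $n\ge0$, $\mathsf H\text{-}\dim X\le n+1$ if and only if $\mathsf H\text{-}\dim X'\le n$. For modules $X,Y$, the *depth-formula condition* holds for $(X,Y,\mathsf H)$ if, whenever $X$ and $Y$ are nonzero and $\operatorname{Tor}_1^R(X,Y)=0$, one has $\mathsf H\text{-}\dim X=\operatorname{depth}Y-\operatorname{depth}(X\otimes_RY)$. **Theorem.** Let $M$ and $N$ be nonzero $R$-modules, and assume that $M$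 satisfies $(\widetilde S_r)$ for some integer $r\ge0$. (1) If $\operatorname{G\text{-}dim}(\operatorname{Tr}M)<\infty$, then $\operatorname{Ext}^i_R(\operatorname{Tr}M,R)=0$ for all $1\le i\le r$. (2) Assume $\operatorname{Ext}^n_R(M,N)=0$ for some integer $n\ge1$. (i) If $N$ is strongly-rigid and $\operatorname{depth}R\le n+r$, then $\operatorname{pd}M\le n-1$. (ii) If $N$ is Tor-rigid, $\operatorname{depth}N\le n+r$, and the depth-formula condition holds for $(\mathcal T_{n+1}M,N,\mathsf H)$, where $\mathsf H\text{-}\dim$ is a homological dimension, then $\mathsf H\text{-}\dim M\le n-1$. -/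

import Mathlib

open CategoryTheory CategoryTheory.Abelian

universe u

noncomputable section

/-- `Ext^i_R(M, N) = 0`. -/
def ExtVanishes (R : Type u) [CommRing R] (M N : Type u) [AddCommGroup M] [Module R M]
    [AddCommGroup N] [Module R N] (i : ℕ) : Prop :=
  Subsingleton (Ext (ModuleCat.of R M) (ModuleCat.of R N) i)

/-- `Tor_i^R(M, N) = 0`. -/
def TorVanishes (R : Type u) [CommRing R] (M N : Type u) [AddCommGroup M] [Module R M]
    [AddCommGroup N] [Module R N] (i : ℕ) : Prop :=
  Limits.IsZero (((Tor (ModuleCat.{u} R) i).obj (ModuleCat.of R M)).obj (ModuleCat.of R N))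

/-- The projective dimension `pd_R(M)`; it is `⊥` exactly when `M = 0`, and `⊤` when infinite. -/
def pDim (R : Type u) [CommRing R] (M : Type u) [AddCommGroup M] [Module R M] : WithBot ℕ∞ :=
  projectiveDimension (ModuleCat.of R M)

/-- The depth of a module over a local ring with residue field `k`:
the least `i` with `Ext^i_R(k, M) ≠ 0`. In particular `depth 0 = ∞`. -/
def moduleDepth (R : Type u) [CommRing R] [IsLocalRing R] (M : Type u) [AddCommGroup M]
    [Module R M] : ℕ∞ :=
  ⨅ (i : ℕ) (_ : ¬ ExtVanishes R (IsLocalRing.ResidueField R) M i), (i : ℕ∞)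

/-- The condition `(S̃_r)`: `depth M_p ≥ min (r, depth R_p)` for all `p` in the support of `M`. -/
def SatisfiesSTilde (R : Type u) [CommRing R] (M : Type u) [AddCommGroup M] [Module R M]
    (r : ℕ) : Prop :=
  ∀ p ∈ Module.support R M,
    min (r : ℕ∞) (moduleDepth (Localization.AtPrime p.asIdeal) (Localization.AtPrime p.asIdeal)) ≤
      moduleDepth (Localization.AtPrime p.asIdeal) (LocalizedModule p.asIdeal.primeCompl M)

/-- `N` is Tor-rigid: for all finitely generated `X` and `n ≥ 1`, if `Tor_n(N, X) = 0` then
`Tor_{n+1}(N, X) = 0`. -/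
def TorRigid (R : Type u) [CommRing R] (N : Type u) [AddCommGroup N] [Module R N] : Prop :=
  ∀ (X : Type u) [AddCommGroup X] [Module R X] [Module.Finite R X] (n : ℕ), 1 ≤ n →
    TorVanishes R N X n → TorVanishes R N X (n + 1)

/-- `N` is strongly-rigid: for all finitely generated `X`, if `Tor_n(N, X) = 0` for some `n ≥ 1`
then `pd X < ∞`. -/
def StronglyRigid (R : Type u) [CommRing R] (N : Type u) [AddCommGroup N] [Module R N] : Prop :=
  ∀ (X : Type u) [AddCommGroup X] [Module R X] [Module.Finite R X] (n : ℕ), 1 ≤ n →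
    TorVanishes R N X n → pDim R X < ⊤

/-- `T` is an Auslander transpose of `M`: there is an exact sequence `P₁ → P₀ → M → 0` with
`P₁`, `P₀` finitely generated projective such that `T` is isomorphic to the cokernel of the dual
map `P₀^* → P₁^*`. -/
def IsTranspose (R : Type u) [CommRing R] (M T : Type u) [AddCommGroup M] [Module R M]
    [AddCommGroup T] [Module R T] : Prop :=
  ∃ (P₁ P₀ : Type u) (_ : AddCommGroup P₁) (_ : Module R P₁) (_ : AddCommGroup P₀)
    (_ : Module R P₀) (f : P₁ →ₗ[R] P₀) (g : P₀ →ₗ[R] M),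
    Module.Finite R P₁ ∧ Module.Projective R P₁ ∧ Module.Finite R P₀ ∧ Module.Projective R P₀ ∧
    Function.Exact f g ∧ Function.Surjective g ∧
    Nonempty (T ≃ₗ[R] (Module.Dual R P₁ ⧸ LinearMap.range f.dualMap))

/-- `K` is an `n`-th syzygy of `M`, computed with finitely generated projective modules. -/
def IsSyzygy (R : Type u) [CommRing R] :
    ℕ → ∀ (M K : Type u) [AddCommGroup M] [Module R M] [AddCommGroup K] [Module R K], Prop
  | 0, M, K, _, _, _, _ => Nonempty (K ≃ₗ[R] M)
  | n + 1, M, K, _, _, _, _ =>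
    ∃ (P : Type u) (_ : AddCommGroup P) (_ : Module R P) (g : P →ₗ[R] M),
      Module.Finite R P ∧ Module.Projective R P ∧ Function.Surjective g ∧
      IsSyzygy R n (LinearMap.ker g) K

/-- `T` is a transpose of an `n`-th syzygy of `M`, that is, `T` is a `𝒯_{n+1} M`. -/
def IsTransposeOfSyzygy (R : Type u) [CommRing R] (n : ℕ) (M T : Type u) [AddCommGroup M]
    [Module R M] [AddCommGroup T] [Module R T] : Prop :=
  ∃ (K : Type u) (_ : AddCommGroup K) (_ : Module R K), IsSyzygy R n M K ∧ IsTranspose R K T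

/-- Totally reflexive modules. -/
structure TotallyReflexive (R : Type u) [CommRing R] (M : Type u) [AddCommGroup M]
    [Module R M] : Prop where
  finite : Module.Finite R M
  bijective_eval : Function.Bijective (Module.Dual.eval R M)
  ext_vanishes : ∀ i, 1 ≤ i → ExtVanishes R M R i
  ext_dual_vanishes : ∀ i, 1 ≤ i → ExtVanishes R (Module.Dual R M) R i

/-- There is an exact sequence `0 → X_n → ⋯ → X_0 → M → 0` with all `X_i` totally reflexive. -/
def HasTotallyReflexiveResolution (R : Type u) [CommRing R] :
    ℕ → ∀ (M : Type u) [AddCommGroup M] [Module R M], Prop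
  | 0, M, _, _ => TotallyReflexive R M
  | n + 1, M, _, _ =>
    ∃ (X : Type u) (_ : AddCommGroup X) (_ : Module R X) (g : X →ₗ[R] M),
      TotallyReflexive R X ∧ Function.Surjective g ∧
      HasTotallyReflexiveResolution R n (LinearMap.ker g)

open Classical in
/-- The Gorenstein dimension, with `G-dim 0 = -∞`. -/
def gDim (R : Type u) [CommRing R] (M : Type u) [AddCommGroup M] [Module R M] : WithBot ℕ∞ :=
  if Subsingleton M then ⊥
  else ((⨅ (n : ℕ) (_ : HasTotallyReflexiveResolution R n M), (n : ℕ∞) : ℕ∞) : WithBot ℕ∞)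

/-- A homological dimension `H-dim` of finitely generated `R`-modules (its values on other modules
are irrelevant). -/
structure HomologicalDimension (R : Type u) [CommRing R] where
  /-- The value `H-dim M`. -/
  dim : ∀ (M : Type u) [AddCommGroup M] [Module R M], WithBot ℕ∞
  /-- `H-dim` depends only on the isomorphism class of the module. -/
  dim_congr : ∀ (M M' : Type u) [AddCommGroup M] [Module R M] [AddCommGroup M'] [Module R M']
    [Module.Finite R M], (M ≃ₗ[R] M') → dim M = dim M'
  /-- `G-dim M ≤ H-dim M`. -/
  gDim_le : ∀ (M : Type u) [AddCommGroup M] [Module R M] [Module.Finite R M], gDim R M ≤ dim M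
  /-- `H-dim M ≤ pd M`. -/
  le_pDim : ∀ (M : Type u) [AddCommGroup M] [Module R M] [Module.Finite R M], dim M ≤ pDim R M
  /-- If `H-dim M = 0`, then `Tr M = 0` or `H-dim (Tr M) = 0`. -/
  transpose : ∀ (M T : Type u) [AddCommGroup M] [Module R M] [AddCommGroup T] [Module R T]
    [Module.Finite R M], IsTranspose R M T → dim M = 0 → Subsingleton T ∨ dim T = 0
  /-- Dimension shifting along syzygies, `H-dim (Ω M) = max (H-dim M - 1, 0)` for `Ω M ≠ 0`:
  for `0 → ker g → P → M → 0` exact with `P` projective, `H-dim M ≤ n + 1` if and only if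
  `H-dim (ker g) ≤ n`. -/
  syzygy : ∀ (P M : Type u) [AddCommGroup P] [Module R P] [AddCommGroup M] [Module R M]
    [Module.Finite R P] [Module.Projective R P] (g : P →ₗ[R] M), Function.Surjective g →
    ∀ n : ℕ, dim M ≤ ((n + 1 : ℕ) : WithBot ℕ∞) ↔ dim (LinearMap.ker g) ≤ (n : WithBot ℕ∞)

/-- The depth formula condition for `(X, Y, H)`: for nonzero `X` and `Y`, if `Tor_1(X, Y) = 0`
then `H-dim X = depth Y - depth (X ⊗ Y)`. As `depth (X ⊗ Y)` is finite for nonzero finitely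
generated `X` and `Y`, the equality is written additively. -/
def DepthFormulaCondition (R : Type u) [CommRing R] [IsLocalRing R] (H : HomologicalDimension R)
    (X Y : Type u) [AddCommGroup X] [Module R X] [AddCommGroup Y] [Module R Y] : Prop :=
  Nontrivial X → Nontrivial Y → TorVanishes R X Y 1 →
    H.dim X + ((moduleDepth R (TensorProduct R X Y) : ℕ∞) : WithBot ℕ∞) =
      ((moduleDepth R Y : ℕ∞) : WithBot ℕ∞)

end

/-! Part (1). For `T = Tr M`, the module `Ext¹(T, R)` is the kernel of biduality `M → M**`. If it is
nonzero, an associated prime `p` of it satisfies `depth M_p = 0`, so for `r ≥ 1` the condition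
`(S̃_r)` forces `depth R_p = 0`. Finite G-dimension passes to `T_p`, and the Auslander–Bridger bound
`Ext^j(T_p, R_p) = 0` for `j > depth R_p` kills `Ext¹(T_p, R_p)`, a contradiction. Once `Ext¹(T, R)
= 0`, `M` embeds in a free module with a cokernel `M'` that is a transpose of `ΩT`. The depth
condition for `M'` is weaker by one, so the argument repeats for `Ext²`, and so on up to `Ext^r`
(`TransposePair.ext_vanishes_of_localized_depth`).

Part (2). Replacing `M` by a syzygy lowers `n` and raises `r` by one, so `n + r` is preserved and
the case `n = 1` suffices. Write `Y` for the module and `T = Tr ΩY`. The driving tool is the exact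
sequence `Tor₂(T, N) → Ext¹(Y, R) ⊗ N → Ext¹(Y, N) → Tor₁(T, N) → 0`. Vanishing of `Ext¹(Y, N)`
gives `Tor₁(T, N) = 0`. Strong rigidity then bounds `pd T`, while the depth formula bounds `H-dim T`
by `depth N ≤ r + 1`. Since `ΩY` satisfies `(S̃_{r+1})`, part (1) gives `Ext^i(T, R) = 0` for `1 ≤ i
≤ r + 1`; above that range the depth of `R` or the bound on G-dimension takes over. Hence `T` is
totally reflexive, and a totally reflexive module of finite H-dimension has H-dimension at most
zero. Transposing, the same holds for `ΩY`. Finally `Tor₂(T, N) = 0` and Nakayama give `Ext¹(Y, R) =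
0`, which makes `Y` itself totally reflexive, of H-dimension at most one and therefore at most zero.

Presentations are handled as matrices: a transpose is the cokernel of the transposed matrix, and
exactness of matrix sequences localizes. -/

noncomputable section

open Matrix IsLocalRing TensorProduct

/-! ### Vanishing of Ext along short exact sequences. -/

section ExtAPI

variable {R : Type u} [CommRing R]
variable {A B C X Y : Type u} [AddCommGroup A] [Module R A] [AddCommGroup B] [Module R B]
  [AddCommGroup C] [Module R C] [AddCommGroup X] [Module R X] [AddCommGroup Y] [Module R Y]

/-- The short complex of modules given by two linear maps with zero composition. -/
abbrev linearShortComplex (f : A →ₗ[R] B) (g : B →ₗ[R] C) (h : Function.Exact f g) :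
    ShortComplex (ModuleCat.{u} R) :=
  ShortComplex.mk (ModuleCat.ofHom f) (ModuleCat.ofHom g) (by
    ext x; exact h.apply_apply_eq_zero x)

lemma linearShortComplex_shortExact {f : A →ₗ[R] B} {g : B →ₗ[R] C} (hf : Function.Injective f)
    (hg : Function.Surjective g) (h : Function.Exact f g) :
    (linearShortComplex f g h).ShortExact where
  exact := ModuleCat.shortComplex_exact _ h
  mono_f := (ModuleCat.mono_iff_injective _).2 hf
  epi_g := (ModuleCat.epi_iff_surjective _).2 hg

lemma extVanishes_iff {i : ℕ} : ExtVanishes R A B i ↔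
    ∀ x : Ext (ModuleCat.of R A) (ModuleCat.of R B) i, x = 0 :=
  subsingleton_iff_forall_eq 0

lemma extVanishes_zero_iff : ExtVanishes R A B 0 ↔ ∀ f : A →ₗ[R] B, f = 0 := by
  unfold ExtVanishes
  rw [(Ext.linearEquiv₀ (R := R) (X := ModuleCat.of R A) (Y := ModuleCat.of R B)).toEquiv.subsingleton_congr,
    (ModuleCat.homLinearEquiv (S := R) (M := ModuleCat.of R A)
      (N := ModuleCat.of R B)).toEquiv.subsingleton_congr]
  exact subsingleton_iff_forall_eq 0

lemma ExtVanishes.congr_right {i : ℕ} (e : A ≃ₗ[R] B) (h : ExtVanishes R X A i) :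
    ExtVanishes R X B i := by
  rw [extVanishes_iff] at *
  intro x
  have h1 := h (x.comp (Ext.mk₀ (ModuleCat.ofHom e.symm.toLinearMap)) (add_zero i))
  have h2 : x.comp (Ext.mk₀ (ModuleCat.ofHom e.symm.toLinearMap ≫ ModuleCat.ofHom e.toLinearMap))
      (add_zero i) = 0 := by
    rw [← Ext.mk₀_comp_mk₀, ← Ext.comp_assoc_of_third_deg_zero, h1, Ext.zero_comp]
  rwa [show ModuleCat.ofHom e.symm.toLinearMap ≫ ModuleCat.ofHom e.toLinearMap = 𝟙 _ by
    ext x; simp, Ext.comp_mk₀_id] at h2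

lemma ExtVanishes.congr_left {i : ℕ} (e : A ≃ₗ[R] B) (h : ExtVanishes R A Y i) :
    ExtVanishes R B Y i := by
  rw [extVanishes_iff] at *
  intro x
  have h1 := h ((Ext.mk₀ (ModuleCat.ofHom e.toLinearMap)).comp x (zero_add i))
  have h2 : (Ext.mk₀ (ModuleCat.ofHom e.symm.toLinearMap ≫ ModuleCat.ofHom e.toLinearMap)).comp x
      (zero_add i) = 0 := by
    rw [← Ext.mk₀_comp_mk₀_assoc, h1, Ext.comp_zero]
  rwa [show ModuleCat.ofHom e.symm.toLinearMap ≫ ModuleCat.ofHom e.toLinearMap = 𝟙 _ by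
    ext x; simp, Ext.mk₀_id_comp] at h2

lemma extVanishes_of_projective [Module.Projective R A] (i : ℕ) (hi : 1 ≤ i) :
    ExtVanishes R A Y i := by
  rw [extVanishes_iff]
  intro x
  obtain ⟨j, rfl⟩ : ∃ j, i = j + 1 := ⟨i - 1, by omega⟩
  have : Projective (ModuleCat.of R A) := (IsProjective.iff_projective A).1 inferInstance
  exact Ext.eq_zero_of_projective x

lemma ExtVanishes.of_subsingleton_right [Subsingleton Y] (i : ℕ) : ExtVanishes R A Y i := by
  rw [extVanishes_iff]
  intro x
  have : (𝟙 (ModuleCat.of R Y)) = 0 := by ext y; exact Subsingleton.elim _ _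
  rw [← Ext.comp_mk₀_id x, this, Ext.mk₀_zero, Ext.comp_zero]

variable {f : A →ₗ[R] B} {g : B →ₗ[R] C} (hf : Function.Injective f)
    (hg : Function.Surjective g) (h : Function.Exact f g)
include hf

include hg h

lemma ExtVanishes.cov_one {i : ℕ} (h3 : ExtVanishes R X C i) (h2 : ExtVanishes R X B (i + 1)) :
    ExtVanishes R X A (i + 1) := by
  rw [extVanishes_iff] at *
  intro x
  obtain ⟨y, rfl⟩ := Ext.covariant_sequence_exact₁ (ModuleCat.of R X)
    (linearShortComplex_shortExact hf hg h) x (h2 _) rfl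
  rw [h3 y, Ext.zero_comp]

lemma ExtVanishes.cov_three {i : ℕ} (h2 : ExtVanishes R X B i)
    (h1 : ExtVanishes R X A (i + 1)) : ExtVanishes R X C i := by
  rw [extVanishes_iff] at *
  intro x
  obtain ⟨y, rfl⟩ := Ext.covariant_sequence_exact₃ (ModuleCat.of R X)
    (linearShortComplex_shortExact hf hg h) x rfl (h1 _)
  rw [h2 y, Ext.zero_comp]

lemma ExtVanishes.contra_one {i : ℕ} (h2 : ExtVanishes R B Y i)
    (h3 : ExtVanishes R C Y (i + 1)) : ExtVanishes R A Y i := by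
  rw [extVanishes_iff] at *
  intro x
  obtain ⟨y, rfl⟩ := Ext.contravariant_sequence_exact₁
    (linearShortComplex_shortExact hf hg h) (ModuleCat.of R Y) x (add_comm 1 i) (h3 _)
  rw [h2 y, Ext.comp_zero]

lemma ExtVanishes.contra_three {i : ℕ} (h1 : ExtVanishes R A Y i)
    (h2 : ExtVanishes R B Y (i + 1)) : ExtVanishes R C Y (i + 1) := by
  rw [extVanishes_iff] at *
  intro x
  obtain ⟨y, rfl⟩ := Ext.contravariant_sequence_exact₃
    (linearShortComplex_shortExact hf hg h) (ModuleCat.of R Y) x (h2 _) (add_comm 1 i)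
  rw [h1 y, Ext.comp_zero]

lemma ExtVanishes.succ_iff_of_projective [Module.Projective R B] {i : ℕ} (hi : 1 ≤ i) :
    ExtVanishes R C Y (i + 1) ↔ ExtVanishes R A Y i :=
  ⟨fun h3 => .contra_one hf hg h (extVanishes_of_projective i hi) h3,
    fun h1 => .contra_three hf hg h h1 (extVanishes_of_projective (i + 1) (by omega))⟩

lemma ExtVanishes.exists_extension (h3 : ExtVanishes R C Y 1) (φ : A →ₗ[R] Y) :
    ∃ ψ : B →ₗ[R] Y, ψ ∘ₗ f = φ := by
  rw [extVanishes_iff] at h3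
  obtain ⟨y, hy⟩ := Ext.contravariant_sequence_exact₁
    (linearShortComplex_shortExact hf hg h) (ModuleCat.of R Y)
    (Ext.mk₀ (ModuleCat.ofHom φ)) (add_comm 1 0) (h3 _)
  obtain ⟨ψ, rfl⟩ := (Ext.mk₀_bijective _ _).2 y
  rw [Ext.mk₀_comp_mk₀] at hy
  refine ⟨ψ.hom, ?_⟩
  have := (Ext.mk₀_bijective _ _).1 hy
  exact congrArg ModuleCat.Hom.hom this

lemma extVanishes_one_of_exists_extension (h2 : ExtVanishes R B Y 1)
    (H : ∀ φ : A →ₗ[R] Y, ∃ ψ : B →ₗ[R] Y, ψ ∘ₗ f = φ) : ExtVanishes R C Y 1 := by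
  rw [extVanishes_iff] at *
  intro x
  obtain ⟨y, rfl⟩ := Ext.contravariant_sequence_exact₃
    (linearShortComplex_shortExact hf hg h) (ModuleCat.of R Y) x (h2 _) (add_comm 1 0)
  obtain ⟨φ, rfl⟩ := (Ext.mk₀_bijective _ _).2 y
  obtain ⟨ψ, hψ⟩ := H φ.hom
  have : φ = (linearShortComplex f g h).f ≫ ModuleCat.ofHom ψ := by
    ext x; exact (LinearMap.congr_fun hψ x).symm
  rw [this, ← Ext.mk₀_comp_mk₀]
  exact (linearShortComplex_shortExact hf hg h).extClass_comp_assoc _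

omit hg h in
lemma ExtVanishes.zero_of_injective (h2 : ExtVanishes R X B 0) : ExtVanishes R X A 0 := by
  rw [extVanishes_zero_iff] at *
  intro φ
  ext x
  exact hf (by simpa using LinearMap.congr_fun (h2 (f ∘ₗ φ)) x)

end ExtAPI

lemma exact_ker_subtype {R : Type u} [CommRing R] {B C : Type u} [AddCommGroup B] [Module R B]
    [AddCommGroup C] [Module R C] (g : B →ₗ[R] C) :
    Function.Exact (LinearMap.ker g).subtype g := by
  intro x; simp

/-! ### Presentations by matrices, and Ext into the ring. -/

section MatrixPresentations

variable {R : Type u} [CommRing R] {T T' N : Type u} [AddCommGroup T] [Module R T]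
  [AddCommGroup T'] [Module R T'] [AddCommGroup N] [Module R N] {a b c d : ℕ}

/-- `T` is the cokernel of the matrix `B`. -/
def MatrixPresents (B : Matrix (Fin a) (Fin b) R) (T : Type u) [AddCommGroup T] [Module R T] :
    Prop :=
  ∃ g : (Fin a → R) →ₗ[R] T, Function.Surjective g ∧ Function.Exact B.mulVecLin g

/-- The matrices `C` and `B` form an exact sequence. -/
abbrev MatrixExact (C : Matrix (Fin b) (Fin c) R) (B : Matrix (Fin a) (Fin b) R) : Prop :=
  Function.Exact C.mulVecLin B.mulVecLin

lemma Submodule.FG.exists_matrix_range {K : Submodule R (Fin a → R)} (hK : K.FG) :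
    ∃ (b : ℕ) (B : Matrix (Fin a) (Fin b) R), LinearMap.range B.mulVecLin = K := by
  obtain ⟨n, f, hf⟩ := (Submodule.fg_iff_exists_fin_linearMap R _).1 hK
  exact ⟨n, LinearMap.toMatrix' f, by rw [← Matrix.toLin'_apply', Matrix.toLin'_toMatrix', hf]⟩

lemma exists_matrixExact [IsNoetherianRing R] (B : Matrix (Fin a) (Fin b) R) :
    ∃ (c : ℕ) (C : Matrix (Fin b) (Fin c) R), MatrixExact C B := by
  obtain ⟨c, C, hC⟩ := Submodule.FG.exists_matrix_range
    (IsNoetherian.noetherian (LinearMap.ker B.mulVecLin))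
  exact ⟨c, C, LinearMap.exact_iff.2 hC.symm⟩

lemma exists_matrixPresents_of_surjective [IsNoetherianRing R] {g : (Fin a → R) →ₗ[R] T}
    (hg : Function.Surjective g) :
    ∃ (b : ℕ) (B : Matrix (Fin a) (Fin b) R), MatrixPresents B T := by
  obtain ⟨b, B, hB⟩ := Submodule.FG.exists_matrix_range (IsNoetherian.noetherian (LinearMap.ker g))
  exact ⟨b, B, g, hg, LinearMap.exact_iff.2 hB.symm⟩

variable (R T) in
lemma exists_matrixPresents [IsNoetherianRing R] [Module.Finite R T] :
    ∃ (a b : ℕ) (B : Matrix (Fin a) (Fin b) R), MatrixPresents B T := by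
  obtain ⟨a, g, hg⟩ := Module.Finite.exists_fin' R T
  exact ⟨a, exists_matrixPresents_of_surjective hg⟩

lemma matrixPresents_range {B : Matrix (Fin a) (Fin b) R} {C : Matrix (Fin b) (Fin c) R}
    (h : MatrixExact C B) : MatrixPresents C (LinearMap.range B.mulVecLin) :=
  ⟨B.mulVecLin.rangeRestrict, LinearMap.surjective_rangeRestrict _, fun x => by
    rw [← h x, Subtype.ext_iff]; rfl⟩

lemma matrixPresents_quotient (B : Matrix (Fin a) (Fin b) R) :
    MatrixPresents B ((Fin a → R) ⧸ LinearMap.range B.mulVecLin) :=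
  ⟨Submodule.mkQ _, Submodule.mkQ_surjective _, LinearMap.exact_iff.2 (Submodule.ker_mkQ _)⟩

lemma MatrixPresents.finite {B : Matrix (Fin a) (Fin b) R} (h : MatrixPresents B T) :
    Module.Finite R T := by
  obtain ⟨g, hg, -⟩ := h
  exact Module.Finite.of_surjective g hg

lemma MatrixPresents.congr {B : Matrix (Fin a) (Fin b) R} (e : T ≃ₗ[R] T')
    (h : MatrixPresents B T) : MatrixPresents B T' := by
  obtain ⟨g, hg, h⟩ := h
  exact ⟨e.toLinearMap ∘ₗ g, e.surjective.comp hg, fun x => by rw [← h x]; simp⟩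

lemma MatrixPresents.nonempty_equiv {B : Matrix (Fin a) (Fin b) R} (h : MatrixPresents B T)
    (h' : MatrixPresents B T') : Nonempty (T ≃ₗ[R] T') := by
  obtain ⟨g, hg, h⟩ := h
  obtain ⟨g', hg', h'⟩ := h'
  have e : LinearMap.ker g = LinearMap.ker g' := by
    rw [LinearMap.exact_iff.1 h, LinearMap.exact_iff.1 h']
  exact ⟨(g.quotKerEquivOfSurjective hg).symm.trans
    ((Submodule.quotEquivOfEq _ _ e).trans (g'.quotKerEquivOfSurjective hg'))⟩

/-- The kernel of a presentation is the image of the matrix. -/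
lemma MatrixPresents.exists_shortExact {B : Matrix (Fin a) (Fin b) R}
    {C : Matrix (Fin b) (Fin c) R} (h : MatrixPresents B T) (hCB : MatrixExact C B)
    (h' : MatrixPresents C T') :
    ∃ (f : T' →ₗ[R] (Fin a → R)) (g : (Fin a → R) →ₗ[R] T) (p : (Fin b → R) →ₗ[R] T'),
      Function.Injective f ∧ Function.Surjective g ∧ Function.Exact f g ∧
      Function.Surjective p ∧ Function.Exact C.mulVecLin p ∧ f ∘ₗ p = B.mulVecLin := by
  obtain ⟨g, hg, h⟩ := h
  obtain ⟨p, hp, hCp⟩ := h'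
  have hpB : ∀ x y, p x = p y ↔ B.mulVecLin x = B.mulVecLin y := by
    intro x y
    rw [← sub_eq_zero, ← map_sub, hCp, ← hCB, map_sub, sub_eq_zero]
  let f : T' →ₗ[R] (Fin a → R) :=
    (LinearMap.ker p).liftQ B.mulVecLin (by
      intro x hx
      have := (hpB x 0).1 (by simpa using hx)
      simpa using this) ∘ₗ (p.quotKerEquivOfSurjective hp).symm.toLinearMap
  have hfp : ∀ x, f (p x) = B.mulVecLin x := by
    intro x
    have : (p.quotKerEquivOfSurjective hp).symm (p x) = Submodule.Quotient.mk x := by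
      rw [LinearEquiv.symm_apply_eq]; rfl
    simp only [f, LinearMap.comp_apply, LinearEquiv.coe_coe, this]
    rfl
  refine ⟨f, g, p, ?_, hg, ?_, hp, hCp, LinearMap.ext hfp⟩
  · intro x y hxy
    obtain ⟨x, rfl⟩ := hp x
    obtain ⟨y, rfl⟩ := hp y
    rw [hfp, hfp] at hxy
    exact (hpB x y).2 hxy
  · intro x
    rw [h x]
    constructor
    · rintro ⟨y, rfl⟩
      exact ⟨p y, hfp y⟩
    · rintro ⟨y, rfl⟩
      obtain ⟨y, rfl⟩ := hp y
      exact ⟨y, (hfp y).symm⟩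

lemma MatrixPresents.ext_succ_iff {B : Matrix (Fin a) (Fin b) R}
    {C : Matrix (Fin b) (Fin c) R} (h : MatrixPresents B T) (hCB : MatrixExact C B)
    (h' : MatrixPresents C T') {i : ℕ} (hi : 1 ≤ i) :
    ExtVanishes R T N (i + 1) ↔ ExtVanishes R T' N i := by
  obtain ⟨f, g, p, hf, hg, hfg, -⟩ := h.exists_shortExact hCB h'
  exact ExtVanishes.succ_iff_of_projective hf hg hfg hi

/-- The functional on a finite free module given by a vector. -/
def vecFunctional (v : Fin b → R) : (Fin b → R) →ₗ[R] R :=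
  Fintype.linearCombination R v

lemma vecFunctional_apply (v x : Fin b → R) : vecFunctional v x = x ⬝ᵥ v := by
  simp [vecFunctional, Fintype.linearCombination_apply, dotProduct]

lemma exists_vecFunctional (φ : (Fin b → R) →ₗ[R] R) : ∃ v, φ = vecFunctional v := by
  refine ⟨fun i => φ (Pi.single i 1), ?_⟩
  apply (Pi.basisFun R (Fin b)).ext
  intro i
  simp [vecFunctional_apply]

lemma vecFunctional_injective : Function.Injective (vecFunctional (R := R) (b := b)) := by
  intro v w h
  ext i
  simpa [vecFunctional_apply] using LinearMap.congr_fun h (Pi.single i 1)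

lemma vecFunctional_comp (v : Fin a → R) (B : Matrix (Fin a) (Fin b) R) :
    vecFunctional v ∘ₗ B.mulVecLin = vecFunctional (Bᵀ *ᵥ v) := by
  ext i
  simp only [LinearMap.comp_apply, vecFunctional_apply, mulVecLin_apply]
  rw [dotProduct_comm, dotProduct_mulVec, mulVec_transpose, dotProduct_comm]

lemma vecFunctional_comp_eq_zero_iff (v : Fin a → R) (B : Matrix (Fin a) (Fin b) R) :
    vecFunctional v ∘ₗ B.mulVecLin = 0 ↔ Bᵀ *ᵥ v = 0 := by
  rw [vecFunctional_comp]
  have : vecFunctional (0 : Fin b → R) = 0 := by ext; simp [vecFunctional_apply]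
  rw [← this]
  exact vecFunctional_injective.eq_iff

/-- Maps out of a presented module are maps that kill the relations. -/
lemma Function.Exact.exists_lift {A B C N : Type*} [AddCommGroup A] [Module R A] [AddCommGroup B]
    [Module R B] [AddCommGroup C] [Module R C] [AddCommGroup N] [Module R N] {f : A →ₗ[R] B}
    {p : B →ₗ[R] C} (h : Function.Exact f p) (hp : Function.Surjective p) (φ : B →ₗ[R] N)
    (hφ : φ ∘ₗ f = 0) : ∃ ψ : C →ₗ[R] N, ψ ∘ₗ p = φ := by
  refine ⟨(LinearMap.ker p).liftQ φ ?_ ∘ₗ (p.quotKerEquivOfSurjective hp).symm.toLinearMap, ?_⟩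
  · intro x hx
    obtain ⟨y, rfl⟩ := (h x).1 hx
    exact LinearMap.congr_fun hφ y
  · ext x
    have : (p.quotKerEquivOfSurjective hp).symm (p x) = Submodule.Quotient.mk x := by
      rw [LinearEquiv.symm_apply_eq]; rfl
    simp only [LinearMap.comp_apply, LinearEquiv.coe_coe, this]
    rfl

/-- Functionals on finite free modules are vectors, and restriction along `B` is multiplication by
`Bᵀ`. `Ext¹(T, R)` consists of the functionals on the syzygy `im B` modulo those extending to the
free cover, that is, `ker Cᵀ / im Bᵀ`. -/
lemma MatrixPresents.ext_one_iff {B : Matrix (Fin a) (Fin b) R}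
    {C : Matrix (Fin b) (Fin c) R} (h : MatrixPresents B T) (hCB : MatrixExact C B) :
    ExtVanishes R T R 1 ↔ MatrixExact Bᵀ Cᵀ := by
  obtain ⟨f, g, p, hf, hg, hfg, hp, hCp, hfp⟩ :=
    h.exists_shortExact hCB (matrixPresents_range hCB)
  have hBC : ∀ y, Cᵀ *ᵥ (Bᵀ *ᵥ y) = 0 := by
    intro y
    rw [← vecFunctional_comp_eq_zero_iff, ← vecFunctional_comp, LinearMap.comp_assoc,
      hCB.linearMap_comp_eq_zero, LinearMap.comp_zero]
  constructor
  · intro hE v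
    constructor
    · intro hv
      rw [mulVecLin_apply, ← vecFunctional_comp_eq_zero_iff] at hv
      obtain ⟨φ, hφ⟩ := hCp.exists_lift hp _ hv
      obtain ⟨ψ, hψ⟩ := hE.exists_extension hf hg hfg φ
      obtain ⟨w, rfl⟩ := exists_vecFunctional ψ
      refine ⟨w, vecFunctional_injective ?_⟩
      rw [mulVecLin_apply, ← vecFunctional_comp, ← hφ, ← hψ, LinearMap.comp_assoc, hfp]
    · rintro ⟨y, rfl⟩
      exact hBC y
  · intro hE
    refine extVanishes_one_of_exists_extension hf hg hfg (extVanishes_of_projective 1 le_rfl) ?_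
    intro φ
    obtain ⟨v, hv⟩ := exists_vecFunctional (φ ∘ₗ p)
    have h1 : Cᵀ *ᵥ v = 0 := by
      rw [← vecFunctional_comp_eq_zero_iff, ← hv, LinearMap.comp_assoc,
        hCp.linearMap_comp_eq_zero, LinearMap.comp_zero]
    obtain ⟨w, hw⟩ := (hE v).1 h1
    refine ⟨vecFunctional w, ?_⟩
    rw [← LinearMap.cancel_right hp, LinearMap.comp_assoc, hfp, vecFunctional_comp, hv, ← hw]
    rfl

/-- `M` and `T` are cokernels of transposed matrices. -/
def TransposePair (R : Type u) [CommRing R] (M T : Type u) [AddCommGroup M] [Module R M]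
    [AddCommGroup T] [Module R T] : Prop :=
  ∃ (a b : ℕ) (B : Matrix (Fin a) (Fin b) R), MatrixPresents Bᵀ M ∧ MatrixPresents B T

lemma TransposePair.symm (h : TransposePair R T T') : TransposePair R T' T := by
  obtain ⟨a, b, B, h1, h2⟩ := h
  exact ⟨b, a, Bᵀ, by rwa [transpose_transpose], h1⟩

variable (R T) in
lemma exists_transposePair [IsNoetherianRing R] [Module.Finite R T] :
    ∃ (M : Type u) (_ : AddCommGroup M) (_ : Module R M), TransposePair R T M := by
  obtain ⟨a, b, B, hB⟩ := exists_matrixPresents R T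
  exact ⟨_, _, _, b, a, Bᵀ, by rwa [transpose_transpose], matrixPresents_quotient _⟩

lemma TransposePair.isTranspose (h : TransposePair R T T') : IsTranspose R T T' := by
  obtain ⟨a, b, B, ⟨g, hg, hBg⟩, h2⟩ := h
  refine ⟨Fin a → R, Fin b → R, _, _, _, _, Bᵀ.mulVecLin, g, inferInstance, inferInstance,
    inferInstance, inferInstance, hBg, hg, ?_⟩
  let e : ∀ n : ℕ, (Fin n → R) ≃ₗ[R] Module.Dual R (Fin n → R) := fun n =>
    LinearEquiv.ofBijective
      { toFun := vecFunctional
        map_add' := fun x y => by ext; simp [vecFunctional_apply]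
        map_smul' := fun x y => by ext; simp [vecFunctional_apply] }
      ⟨vecFunctional_injective, fun φ => by
        obtain ⟨v, rfl⟩ := exists_vecFunctional φ; exact ⟨v, rfl⟩⟩
  obtain ⟨e1⟩ := h2.nonempty_equiv (matrixPresents_quotient B)
  refine ⟨e1.trans (Submodule.Quotient.equiv _ _ (e a) ?_)⟩
  ext φ
  constructor
  · rintro ⟨_, ⟨y, rfl⟩, rfl⟩
    refine ⟨vecFunctional y, ?_⟩
    exact (vecFunctional_comp y Bᵀ).trans (by rw [transpose_transpose]; rfl)
  · rintro ⟨ψ, rfl⟩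
    obtain ⟨v, rfl⟩ := exists_vecFunctional ψ
    refine ⟨_, ⟨v, rfl⟩, ?_⟩
    exact ((vecFunctional_comp v Bᵀ).trans (by rw [transpose_transpose]; rfl)).symm

end MatrixPresentations

/-! ### Biduality, total reflexivity and the transpose. -/

section TransposeAndReflexive

variable {R : Type u} [CommRing R] {M T N : Type u} [AddCommGroup M] [Module R M]
  [AddCommGroup T] [Module R T] [AddCommGroup N] [Module R N] {a b c d : ℕ}

lemma exists_lift_of_range_eq {X Y Z : Type*} [AddCommGroup X] [Module R X] [AddCommGroup Y]
    [Module R Y] [AddCommGroup Z] [Module R Z] {ι : X →ₗ[R] Y} (hι : Function.Injective ι)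
    {f : Z →ₗ[R] Y} (h : LinearMap.range f = LinearMap.range ι) :
    ∃ q : Z →ₗ[R] X, Function.Surjective q ∧ ι ∘ₗ q = f := by
  let e := LinearEquiv.ofInjective ι hι
  let q : Z →ₗ[R] X := e.symm.toLinearMap ∘ₗ
    LinearMap.codRestrict (LinearMap.range ι) f (fun z => h ▸ LinearMap.mem_range_self f z)
  have hq : ∀ z, ι (q z) = f z := by
    intro z
    have : e (q z) = ⟨f z, h ▸ LinearMap.mem_range_self f z⟩ := e.apply_symm_apply _
    exact congrArg Subtype.val this
  refine ⟨q, ?_, LinearMap.ext hq⟩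
  intro x
  obtain ⟨z, hz⟩ : ι x ∈ LinearMap.range f := h ▸ LinearMap.mem_range_self ι x
  exact ⟨z, hι ((hq z).trans hz)⟩

/-- A functional on `M = coker Bᵀ` is a vector killed by `B`, and `ker B = im C`; the columns of `C`
therefore generate `M*`. -/
lemma MatrixPresents.exists_dual_presentation {B : Matrix (Fin a) (Fin b) R}
    {C : Matrix (Fin b) (Fin c) R} (hM : MatrixPresents Bᵀ M) (hCB : MatrixExact C B) :
    ∃ (g : (Fin b → R) →ₗ[R] M) (q : (Fin c → R) →ₗ[R] Module.Dual R M),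
      Function.Surjective g ∧ Function.Exact Bᵀ.mulVecLin g ∧ Function.Surjective q ∧
      (∀ y, q y ∘ₗ g = vecFunctional (C *ᵥ y)) := by
  obtain ⟨g, hg, hBg⟩ := hM
  let ι : Module.Dual R M →ₗ[R] (Fin b → R) :=
    { toFun := fun φ j => φ (g (Pi.single j 1))
      map_add' := fun _ _ => rfl
      map_smul' := fun _ _ => rfl }
  have hvec : ∀ φ : Module.Dual R M, vecFunctional (ι φ) = φ ∘ₗ g := by
    intro φ
    apply (Pi.basisFun R (Fin b)).ext
    intro i
    simp [vecFunctional_apply, ι]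
  have hι : Function.Injective ι := by
    intro φ ψ h
    rw [← LinearMap.cancel_right hg, ← hvec, ← hvec, h]
  have hr : LinearMap.range C.mulVecLin = LinearMap.range ι := by
    rw [← LinearMap.exact_iff.1 hCB]
    ext v
    rw [LinearMap.mem_ker, mulVecLin_apply]
    have hv := vecFunctional_comp_eq_zero_iff v Bᵀ
    rw [transpose_transpose] at hv
    rw [← hv]
    constructor
    · intro h
      obtain ⟨φ, hφ⟩ := hBg.exists_lift hg _ h
      exact ⟨φ, vecFunctional_injective ((hvec φ).trans hφ)⟩
    · rintro ⟨φ, rfl⟩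
      rw [hvec, LinearMap.comp_assoc, hBg.linearMap_comp_eq_zero, LinearMap.comp_zero]
  obtain ⟨q, hq, hιq⟩ := exists_lift_of_range_eq hι hr
  refine ⟨g, q, hg, hBg, hq, fun y => ?_⟩
  rw [← hvec]
  exact congrArg vecFunctional (LinearMap.congr_fun hιq y)

lemma MatrixPresents.dual {B : Matrix (Fin a) (Fin b) R} {C : Matrix (Fin b) (Fin c) R}
    {D : Matrix (Fin c) (Fin d) R} (hM : MatrixPresents Bᵀ M) (hCB : MatrixExact C B)
    (hDC : MatrixExact D C) : MatrixPresents D (Module.Dual R M) := by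
  obtain ⟨g, q, hg, hBg, hq, h⟩ := hM.exists_dual_presentation hCB
  refine ⟨q, hq, fun y => ?_⟩
  rw [← hDC y, mulVecLin_apply]
  have h0 : vecFunctional (0 : Fin b → R) = 0 := by ext; simp [vecFunctional_apply]
  constructor
  · intro hy
    apply vecFunctional_injective
    rw [← h, hy, LinearMap.zero_comp, h0]
  · intro hy
    rw [← LinearMap.cancel_right hg, h, hy, h0, LinearMap.zero_comp]

/-- Since `C` parametrizes all of `M*`, the class of `x` dies in `M**` exactly when `Cᵀ x = 0`. The
kernel of biduality is thus `ker Cᵀ / im Bᵀ`, which is `Ext¹` of the transpose into `R`. -/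
lemma MatrixPresents.eval_injective_iff {B : Matrix (Fin a) (Fin b) R}
    {C : Matrix (Fin b) (Fin c) R} (hM : MatrixPresents Bᵀ M) (hCB : MatrixExact C B) :
    Function.Injective (Module.Dual.eval R M) ↔ ∀ x, Cᵀ *ᵥ x = 0 → ∃ y, Bᵀ *ᵥ y = x := by
  obtain ⟨g, q, hg, hBg, hq, h⟩ := hM.exists_dual_presentation hCB
  have key : ∀ x, Module.Dual.eval R M (g x) = 0 ↔ Cᵀ *ᵥ x = 0 := by
    intro x
    rw [← vecFunctional_comp_eq_zero_iff]
    constructor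
    · intro hx
      ext y
      have := LinearMap.congr_fun hx (q (Pi.single y 1))
      have h' := LinearMap.congr_fun (h (Pi.single y 1)) x
      rw [Module.Dual.eval_apply] at this
      rw [LinearMap.comp_apply, vecFunctional_apply] at h'
      rw [h'] at this
      simpa [vecFunctional_apply, dotProduct_comm] using this
    · intro hx
      ext φ
      obtain ⟨y, rfl⟩ := hq φ
      have h' := LinearMap.congr_fun (h y) x
      rw [LinearMap.comp_apply, vecFunctional_apply, dotProduct_comm] at h'
      have := LinearMap.congr_fun hx y
      rw [LinearMap.comp_apply, vecFunctional_apply] at this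
      rw [Module.Dual.eval_apply, h']
      exact this
  rw [injective_iff_map_eq_zero]
  constructor
  · intro H x hx
    obtain ⟨y, hy⟩ := (hBg x).1 (H _ ((key x).2 hx))
    exact ⟨y, hy⟩
  · intro H m hm
    obtain ⟨x, rfl⟩ := hg m
    exact (hBg x).2 (H x ((key x).1 hm))

/-- As `M* = coker D`, the bidual is `ker Dᵀ`, and the image of `M` in it is `im Cᵀ`. The cokernel
of biduality is therefore `Ext²` of the transpose into `R`. -/
lemma MatrixPresents.eval_surjective_iff {B : Matrix (Fin a) (Fin b) R}
    {C : Matrix (Fin b) (Fin c) R} {D : Matrix (Fin c) (Fin d) R} (hM : MatrixPresents Bᵀ M)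
    (hCB : MatrixExact C B) (hDC : MatrixExact D C) :
    Function.Surjective (Module.Dual.eval R M) ↔ ∀ x, Dᵀ *ᵥ x = 0 → ∃ y, Cᵀ *ᵥ y = x := by
  obtain ⟨g, q, hg, hBg, hq, h⟩ := hM.exists_dual_presentation hCB
  have hDq : Function.Exact D.mulVecLin q := by
    intro y
    rw [← hDC y, mulVecLin_apply]
    have h0 : vecFunctional (0 : Fin b → R) = 0 := by ext; simp [vecFunctional_apply]
    constructor
    · intro hy
      apply vecFunctional_injective
      rw [← h, hy, LinearMap.zero_comp, h0]
    · intro hy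
      rw [← LinearMap.cancel_right hg, h, hy, h0, LinearMap.zero_comp]
  have key : ∀ x, Module.Dual.eval R M (g x) ∘ₗ q = vecFunctional (Cᵀ *ᵥ x) := by
    intro x
    rw [← vecFunctional_comp]
    ext y
    simp only [LinearMap.comp_apply, Module.Dual.eval_apply]
    have h' := LinearMap.congr_fun (h (LinearMap.single R (fun _ => R) y 1)) x
    rw [LinearMap.comp_apply, vecFunctional_apply, dotProduct_comm] at h'
    rw [h', vecFunctional_apply, mulVecLin_apply]
  constructor
  · intro H x hx
    rw [← vecFunctional_comp_eq_zero_iff] at hx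
    obtain ⟨τ, hτ⟩ := hDq.exists_lift hq _ hx
    obtain ⟨m, rfl⟩ := H τ
    obtain ⟨y, rfl⟩ := hg m
    exact ⟨y, vecFunctional_injective ((key y).symm.trans hτ)⟩
  · intro H τ
    obtain ⟨x, hx⟩ := exists_vecFunctional (τ ∘ₗ q)
    have h1 : Dᵀ *ᵥ x = 0 := by
      rw [← vecFunctional_comp_eq_zero_iff, ← hx, LinearMap.comp_assoc,
        hDq.linearMap_comp_eq_zero, LinearMap.comp_zero]
    obtain ⟨y, rfl⟩ := H x h1
    refine ⟨g y, ?_⟩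
    rw [← LinearMap.cancel_right hq, key, hx]

lemma matrixExact_transpose {B : Matrix (Fin a) (Fin b) R} {C : Matrix (Fin b) (Fin c) R}
    (hCB : MatrixExact C B) :
    MatrixExact Bᵀ Cᵀ ↔ ∀ x, Cᵀ *ᵥ x = 0 → ∃ y, Bᵀ *ᵥ y = x := by
  refine ⟨fun h x hx => (h x).1 hx, fun h x => ⟨h x, ?_⟩⟩
  rintro ⟨y, rfl⟩
  rw [mulVecLin_apply, mulVecLin_apply, ← vecFunctional_comp_eq_zero_iff, ← vecFunctional_comp,
    LinearMap.comp_assoc, hCB.linearMap_comp_eq_zero, LinearMap.comp_zero]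

/-- Total reflexivity in terms of a module and its transpose. -/
lemma TransposePair.totallyReflexive_iff [IsNoetherianRing R] (h : TransposePair R M T) :
    TotallyReflexive R M ↔
      (∀ i, 1 ≤ i → ExtVanishes R M R i) ∧ ∀ i, 1 ≤ i → ExtVanishes R T R i := by
  obtain ⟨a, b, B, hM, hT⟩ := h
  obtain ⟨c, C, hCB⟩ := exists_matrixExact B
  obtain ⟨d, D, hDC⟩ := exists_matrixExact C
  have e1 := (hT.ext_one_iff hCB).trans (matrixExact_transpose hCB)
  have hT' := matrixPresents_range hCB
  have e2 := ((hT.ext_succ_iff hCB hT' (N := R) (i := 1) le_rfl).trans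
    (hT'.ext_one_iff hDC)).trans (matrixExact_transpose hDC)
  -- `M*` is a second syzygy of `T`, so the Ext modules agree after a shift by two.
  have e3 : ∀ i, 1 ≤ i → (ExtVanishes R T R (i + 2) ↔ ExtVanishes R (Module.Dual R M) R i) :=
    fun i hi => (hT.ext_succ_iff hCB hT' (N := R) (i := i + 1) (by omega)).trans
      (hT'.ext_succ_iff hDC (hM.dual hCB hDC) hi)
  constructor
  · intro hR
    refine ⟨hR.ext_vanishes, ?_⟩
    intro i hi
    obtain rfl | rfl | hi : i = 1 ∨ i = 2 ∨ 3 ≤ i := by omega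
    · exact e1.2 ((hM.eval_injective_iff hCB).1 hR.bijective_eval.1)
    · exact e2.2 ((hM.eval_surjective_iff hCB hDC).1 hR.bijective_eval.2)
    · obtain ⟨j, rfl⟩ : ∃ j, i = j + 2 := ⟨i - 2, by omega⟩
      exact (e3 j (by omega)).2 (hR.ext_dual_vanishes j (by omega))
  · rintro ⟨hME, hTE⟩
    exact ⟨hM.finite, ⟨(hM.eval_injective_iff hCB).2 (e1.1 (hTE 1 le_rfl)),
      (hM.eval_surjective_iff hCB hDC).2 (e2.1 (hTE 2 (by omega)))⟩, hME,
      fun i hi => (e3 i hi).1 (hTE _ (by omega))⟩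

/-- Over a local ring finitely generated projectives are free, so after choosing bases any
presentation is a matrix and its dual map is the transposed matrix. -/
lemma IsTranspose.transposePair [IsLocalRing R] (h : IsTranspose R M T) :
    TransposePair R M T := by
  obtain ⟨P₁, P₀, _, _, _, _, f, g, _, _, _, _, hfg, hg, ⟨e⟩⟩ := h
  have : Module.Free R P₁ := Module.free_of_flat_of_isLocalRing
  have : Module.Free R P₀ := Module.free_of_flat_of_isLocalRing
  let e₁ := (Module.finBasis R P₁).equivFun
  let e₀ := (Module.finBasis R P₀).equivFun
  obtain ⟨B, hB⟩ : ∃ B, B.mulVecLin = e₀.toLinearMap ∘ₗ f ∘ₗ e₁.symm.toLinearMap :=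
    ⟨LinearMap.toMatrix' (e₀.toLinearMap ∘ₗ f ∘ₗ e₁.symm.toLinearMap), by
      rw [← Matrix.toLin'_apply', Matrix.toLin'_toMatrix']⟩
  have hBx : ∀ x, B.mulVecLin x = e₀ (f (e₁.symm x)) := LinearMap.congr_fun hB
  have hM : MatrixPresents B M := by
    refine ⟨g ∘ₗ e₀.symm.toLinearMap, hg.comp e₀.symm.surjective, fun x => ?_⟩
    rw [LinearMap.comp_apply, hfg]
    constructor
    · rintro ⟨y, hy⟩
      refine ⟨e₁ y, ?_⟩
      rw [hBx, e₁.symm_apply_apply, hy]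
      simp
    · rintro ⟨y, rfl⟩
      exact ⟨e₁.symm y, by rw [hBx]; simp⟩
  have hT : MatrixPresents Bᵀ (Module.Dual R P₁ ⧸ LinearMap.range f.dualMap) := by
    let q : (Fin _ → R) →ₗ[R] Module.Dual R P₁ :=
      { toFun := fun v => vecFunctional v ∘ₗ e₁.toLinearMap
        map_add' := fun x y => by ext; simp [vecFunctional_apply]
        map_smul' := fun x y => by ext; simp [vecFunctional_apply] }
    refine ⟨Submodule.mkQ _ ∘ₗ q, (Submodule.mkQ_surjective _).comp ?_, fun v => ?_⟩
    · intro φ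
      obtain ⟨v, hv⟩ := exists_vecFunctional (φ ∘ₗ e₁.symm.toLinearMap)
      refine ⟨v, ?_⟩
      change vecFunctional v ∘ₗ e₁.toLinearMap = φ
      rw [← hv]
      ext; simp
    · rw [LinearMap.comp_apply, Submodule.mkQ_apply, Submodule.Quotient.mk_eq_zero]
      constructor
      · rintro ⟨φ, hφ⟩
        obtain ⟨w, hw⟩ := exists_vecFunctional (φ ∘ₗ e₀.symm.toLinearMap)
        refine ⟨w, vecFunctional_injective ?_⟩
        rw [mulVecLin_apply, ← vecFunctional_comp, ← hw, hB]
        ext x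
        have := LinearMap.congr_fun hφ (e₁.symm (LinearMap.single R (fun _ => R) x 1))
        simpa [q] using this
      · rintro ⟨w, rfl⟩
        refine ⟨vecFunctional w ∘ₗ e₀.toLinearMap, ?_⟩
        change _ = vecFunctional (Bᵀ *ᵥ w) ∘ₗ e₁.toLinearMap
        rw [← vecFunctional_comp, hB]
        ext x
        simp
  exact ⟨_, _, Bᵀ, by rwa [transpose_transpose], hT.congr e.symm⟩

/-- The transpose of a projective module is projective. -/
lemma TransposePair.projective [Module.Projective R M] (h : TransposePair R M T) :
    Module.Projective R T := by
  obtain ⟨a, b, B, ⟨g, hg, hBg⟩, ⟨q, hq, hBq⟩⟩ := h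
  obtain ⟨s, hs⟩ := Module.projective_lifting_property g LinearMap.id hg
  have hr : ∀ x, LinearMap.id (R := R) x - s (g x) ∈ LinearMap.range Bᵀ.mulVecLin := by
    intro x
    rw [← LinearMap.exact_iff.1 hBg, LinearMap.mem_ker, map_sub, sub_eq_zero]
    exact (LinearMap.congr_fun hs (g x)).symm
  obtain ⟨σ, hσ⟩ := Module.projective_lifting_property Bᵀ.mulVecLin.rangeRestrict
    ((LinearMap.id - s ∘ₗ g).codRestrict (LinearMap.range Bᵀ.mulVecLin) hr)
    (LinearMap.surjective_rangeRestrict _)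
  obtain ⟨S, rfl⟩ : ∃ S : Matrix _ _ R, S.mulVecLin = σ :=
    ⟨LinearMap.toMatrix' σ, by rw [← Matrix.toLin'_apply', Matrix.toLin'_toMatrix']⟩
  -- A splitting of `M` yields a generalized inverse `S` of `Bᵀ`. Transposing this identity gives
  -- one for `B`, which in turn splits the cover of `T`.
  have hBSB : Bᵀ * S * Bᵀ = Bᵀ := by
    apply Matrix.mulVec_injective
    ext1 x
    have h1 := congrArg Subtype.val (LinearMap.congr_fun hσ (Bᵀ.mulVecLin x))
    have h2 : g (Bᵀ.mulVecLin x) = 0 := hBg.apply_apply_eq_zero x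
    simp only [LinearMap.comp_apply, LinearMap.codRestrict_apply, LinearMap.sub_apply,
      LinearMap.id_apply, h2, map_zero, sub_zero] at h1
    rw [← Matrix.mulVec_mulVec, ← Matrix.mulVec_mulVec]
    exact h1
  have hBSB' : B * (Sᵀ * B) = B := by
    rw [← transpose_inj, ← hBSB]
    simp [transpose_mul, hBSB]
  obtain ⟨l, hl⟩ := hBq.exists_lift hq (LinearMap.id - B.mulVecLin ∘ₗ Sᵀ.mulVecLin) (by
    rw [LinearMap.sub_comp, LinearMap.comp_assoc, ← Matrix.mulVecLin_mul,
      ← Matrix.mulVecLin_mul, hBSB']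
    simp)
  refine Module.Projective.of_split l q ?_
  rw [← LinearMap.cancel_right hq, LinearMap.comp_assoc, hl, LinearMap.comp_sub,
    ← LinearMap.comp_assoc, hBq.linearMap_comp_eq_zero]
  simp

end TransposeAndReflexive

/-! ### Resolutions by totally reflexive modules. -/

section Resolutions

variable {R : Type u} [CommRing R] {M M' T X A : Type u} [AddCommGroup M]
  [Module R M] [AddCommGroup M'] [Module R M'] [AddCommGroup T] [Module R T] [AddCommGroup X]
  [Module R X] [AddCommGroup A] [Module R A]

lemma TransposePair.congr_left (e : M ≃ₗ[R] M') (h : TransposePair R M T) :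
    TransposePair R M' T := by
  obtain ⟨a, b, B, h1, h2⟩ := h
  exact ⟨a, b, B, h1.congr e, h2⟩

lemma TotallyReflexive.congr [IsNoetherianRing R] (e : M ≃ₗ[R] M') (h : TotallyReflexive R M) :
    TotallyReflexive R M' := by
  have := h.finite
  obtain ⟨T, _, _, hT⟩ := exists_transposePair R M
  have h' := hT.totallyReflexive_iff.1 h
  exact (hT.congr_left e).totallyReflexive_iff.2
    ⟨fun i hi => (h'.1 i hi).congr_left e, h'.2⟩

lemma HasTotallyReflexiveResolution.congr [IsNoetherianRing R] {n : ℕ} (e : M ≃ₗ[R] M')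
    (h : HasTotallyReflexiveResolution R n M) : HasTotallyReflexiveResolution R n M' := by
  induction n generalizing M M' with
  | zero => exact TotallyReflexive.congr e h
  | succ n ih =>
    obtain ⟨X, _, _, g, hX, hg, hK⟩ := h
    refine ⟨X, _, _, e.toLinearMap ∘ₗ g, hX, e.surjective.comp hg, ?_⟩
    exact ih (LinearEquiv.ofEq _ _ (LinearEquiv.ker_comp e g).symm) hK

/-- The kernel of the second map of a short exact sequence. -/
lemma nonempty_equiv_ker {f : A →ₗ[R] X} {g : X →ₗ[R] M} (hf : Function.Injective f)
    (h : Function.Exact f g) : Nonempty (A ≃ₗ[R] LinearMap.ker g) :=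
  ⟨(LinearEquiv.ofInjective f hf).trans (LinearEquiv.ofEq _ _ (LinearMap.exact_iff.1 h).symm)⟩

lemma HasTotallyReflexiveResolution.succ_of_exact [IsNoetherianRing R] {n : ℕ} {f : A →ₗ[R] X} {g : X →ₗ[R] M}
    (hf : Function.Injective f) (hg : Function.Surjective g) (h : Function.Exact f g)
    (hX : TotallyReflexive R X) (hA : HasTotallyReflexiveResolution R n A) :
    HasTotallyReflexiveResolution R (n + 1) M := by
  obtain ⟨e⟩ := nonempty_equiv_ker hf h
  exact ⟨X, _, _, g, hX, hg, hA.congr e⟩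

lemma HasTotallyReflexiveResolution.ext_vanishes {n : ℕ}
    (h : HasTotallyReflexiveResolution R n M) {j : ℕ} (hj : n + 1 ≤ j) :
    ExtVanishes R M R j := by
  induction n generalizing M j with
  | zero => exact TotallyReflexive.ext_vanishes h j hj
  | succ n ih =>
    obtain ⟨X, _, _, g, hX, hg, hK⟩ := h
    obtain ⟨i, rfl⟩ : ∃ i, j = i + 1 := ⟨j - 1, by omega⟩
    exact .contra_three (Submodule.subtype_injective _) hg (exact_ker_subtype g)
      (ih hK (by omega)) (hX.ext_vanishes _ (by omega))

lemma totallyReflexive_of_projective [Module.Finite R M] [Module.Projective R M] :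
    TotallyReflexive R M where
  finite := inferInstance
  bijective_eval := Module.bijective_dual_eval R M
  ext_vanishes i hi := extVanishes_of_projective i hi
  ext_dual_vanishes i hi := extVanishes_of_projective i hi

end Resolutions

/-! ### Localization of matrices, Ext vanishing and resolutions. -/

section Localization

variable {R : Type u} [CommRing R] (W : Submonoid R) {M T : Type u} [AddCommGroup M] [Module R M]
  [AddCommGroup T] [Module R T] {a b c d : ℕ}

/-- Localization of vectors. -/
abbrev vecLocalize (a : ℕ) : (Fin a → R) →ₗ[R] (Fin a → Localization W) :=
  LinearMap.pi fun i => Algebra.linearMap R (Localization W) ∘ₗ LinearMap.proj i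

/-- Localization of matrices. -/
abbrev matLocalize (B : Matrix (Fin a) (Fin b) R) : Matrix (Fin a) (Fin b) (Localization W) :=
  B.map (algebraMap R (Localization W))

lemma matLocalize_mulVecLin (B : Matrix (Fin a) (Fin b) R) :
    IsLocalizedModule.map W (vecLocalize W b) (vecLocalize W a) B.mulVecLin =
      (matLocalize W B).mulVecLin.restrictScalars R := by
  apply IsLocalizedModule.linearMap_ext W (vecLocalize W b) (vecLocalize W a)
  rw [IsLocalizedModule.map_comp]
  ext x i
  simp [Matrix.mulVec, dotProduct, Pi.single_apply, apply_ite]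

lemma MatrixExact.localize {B : Matrix (Fin a) (Fin b) R} {C : Matrix (Fin b) (Fin c) R}
    (h : MatrixExact C B) : MatrixExact (matLocalize W C) (matLocalize W B) := by
  have := IsLocalizedModule.map_exact W (vecLocalize W c) (vecLocalize W b) (vecLocalize W a)
    C.mulVecLin B.mulVecLin h
  rwa [matLocalize_mulVecLin, matLocalize_mulVecLin] at this

lemma MatrixPresents.localize_aux {B : Matrix (Fin a) (Fin b) R} {g : (Fin a → R) →ₗ[R] T}
    (hg : Function.Surjective g) (h : Function.Exact B.mulVecLin g) :
    ∃ g' : (Fin a → Localization W) →ₗ[Localization W] LocalizedModule W T,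
      Function.Surjective g' ∧ Function.Exact (matLocalize W B).mulVecLin g' ∧
      ∀ x, g' (vecLocalize W a x) = LocalizedModule.mkLinearMap W T (g x) := by
  refine ⟨(IsLocalizedModule.map W (vecLocalize W a)
    (LocalizedModule.mkLinearMap W T) g).extendScalarsOfIsLocalization W (Localization W),
    ?_, ?_, ?_⟩
  · exact IsLocalizedModule.map_surjective W _ _ _ hg
  · have := IsLocalizedModule.map_exact W (vecLocalize W b) (vecLocalize W a)
      (LocalizedModule.mkLinearMap W T) B.mulVecLin g h
    rwa [matLocalize_mulVecLin] at this
  · intro x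
    exact IsLocalizedModule.map_apply W (vecLocalize W a) (LocalizedModule.mkLinearMap W T) g x

lemma MatrixPresents.localize {B : Matrix (Fin a) (Fin b) R} (h : MatrixPresents B T) :
    MatrixPresents (matLocalize W B) (LocalizedModule W T) := by
  obtain ⟨g, hg, h⟩ := h
  obtain ⟨g', h1, h2, -⟩ := MatrixPresents.localize_aux W hg h
  exact ⟨g', h1, h2⟩

lemma TransposePair.localize (h : TransposePair R M T) :
    TransposePair (Localization W) (LocalizedModule W M) (LocalizedModule W T) := by
  obtain ⟨a, b, B, h1, h2⟩ := h
  exact ⟨a, b, matLocalize W B, h1.localize W, h2.localize W⟩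

/-- Vanishing of `Ext¹(T, R)` is exactness of a sequence of matrices, which localizes; higher
degrees follow by passing to syzygies. No comparison map between the Ext modules over the two rings
is needed. -/
lemma MatrixPresents.ext_localize [IsNoetherianRing R] {B : Matrix (Fin a) (Fin b) R}
    (h : MatrixPresents B T) {i : ℕ} (hi : 1 ≤ i) (hT : ExtVanishes R T R i) :
    ExtVanishes (Localization W) (LocalizedModule W T) (Localization W) i := by
  induction i, hi using Nat.le_induction generalizing a b T with
  | base =>
    obtain ⟨c, C, hCB⟩ := exists_matrixExact B
    rw [h.ext_one_iff hCB] at hT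
    rw [(h.localize W).ext_one_iff (hCB.localize W)]
    exact hT.localize W
  | succ i hi ih =>
    obtain ⟨c, C, hCB⟩ := exists_matrixExact B
    have h' := matrixPresents_range hCB
    rw [h.ext_succ_iff hCB h' hi] at hT
    rw [(h.localize W).ext_succ_iff (hCB.localize W) (h'.localize W) hi]
    exact ih h' hT

lemma ExtVanishes.localize [IsNoetherianRing R] [Module.Finite R T] {i : ℕ} (hi : 1 ≤ i)
    (hT : ExtVanishes R T R i) :
    ExtVanishes (Localization W) (LocalizedModule W T) (Localization W) i := by
  obtain ⟨a, b, B, hB⟩ := exists_matrixPresents R T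
  exact hB.ext_localize W hi hT

lemma TotallyReflexive.localize [IsNoetherianRing R] (h : TotallyReflexive R M) :
    TotallyReflexive (Localization W) (LocalizedModule W M) := by
  have := h.finite
  obtain ⟨T, _, _, hT⟩ := exists_transposePair R M
  have : Module.Finite R T := by obtain ⟨_, _, _, -, h2⟩ := hT; exact h2.finite
  have h' := hT.totallyReflexive_iff.1 h
  have : IsNoetherianRing (Localization W) := IsLocalization.isNoetherianRing W _ inferInstance
  exact (hT.localize W).totallyReflexive_iff.2
    ⟨fun i hi => (h'.1 i hi).localize W hi, fun i hi => (h'.2 i hi).localize W hi⟩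

/-- Localization of a linear map, linear over the localized ring. -/
abbrev linLocalize (f : M →ₗ[R] T) :
    LocalizedModule W M →ₗ[Localization W] LocalizedModule W T :=
  LocalizedModule.map W f

lemma linLocalize_injective {f : M →ₗ[R] T} (h : Function.Injective f) :
    Function.Injective (linLocalize W f) := LocalizedModule.map_injective W f h

lemma linLocalize_surjective {f : M →ₗ[R] T} (h : Function.Surjective f) :
    Function.Surjective (linLocalize W f) := LocalizedModule.map_surjective W f h

lemma linLocalize_exact {X : Type u} [AddCommGroup X] [Module R X] {f : M →ₗ[R] T}
    {g : T →ₗ[R] X} (h : Function.Exact f g) :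
    Function.Exact (linLocalize W f) (linLocalize W g) := LocalizedModule.map_exact W f g h

lemma HasTotallyReflexiveResolution.localize [IsNoetherianRing R] {n : ℕ}
    (h : HasTotallyReflexiveResolution R n M) :
    HasTotallyReflexiveResolution (Localization W) n (LocalizedModule W M) := by
  have : IsNoetherianRing (Localization W) := IsLocalization.isNoetherianRing W _ inferInstance
  induction n generalizing M with
  | zero => exact TotallyReflexive.localize W h
  | succ n ih =>
    obtain ⟨X, _, _, g, hX, hg, hK⟩ := h
    exact .succ_of_exact (linLocalize_injective W (Submodule.subtype_injective _))
      (linLocalize_surjective W hg) (linLocalize_exact W (exact_ker_subtype g))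
      (hX.localize W) (ih hK)

end Localization

/-! ### The isomorphism `Ext^d(X, Y*) ≅ Hom(Y, Ext^d(X, R))` below the first nonvanishing degree. -/

section ExtIntoDuals

variable {R : Type u} [CommRing R] {X Y Z A B : Type u} [AddCommGroup X] [Module R X]
  [AddCommGroup Y] [Module R Y] [AddCommGroup Z] [Module R Z] [AddCommGroup A] [Module R A]
  [AddCommGroup B] [Module R B]

/-- Composition of an extension class with a linear map. -/
abbrev extPush {d : ℕ} (ξ : Ext (ModuleCat.of R X) (ModuleCat.of R Y) d) (f : Y →ₗ[R] Z) :
    Ext (ModuleCat.of R X) (ModuleCat.of R Z) d :=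
  ξ.comp (Ext.mk₀ (ModuleCat.ofHom f)) (add_zero d)

lemma extPush_extPush {d : ℕ} (ξ : Ext (ModuleCat.of R X) (ModuleCat.of R Y) d)
    (f : Y →ₗ[R] Z) (g : Z →ₗ[R] A) : extPush (extPush ξ f) g = extPush ξ (g ∘ₗ f) := by
  simp [extPush]

lemma extPush_id {d : ℕ} (ξ : Ext (ModuleCat.of R X) (ModuleCat.of R Y) d) :
    extPush ξ LinearMap.id = ξ := Ext.comp_mk₀_id ξ

lemma extPush_zero {d : ℕ} (f : Y →ₗ[R] Z) :
    extPush (0 : Ext (ModuleCat.of R X) (ModuleCat.of R Y) d) f = 0 := Ext.zero_comp ..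

lemma extPush_sum {ι : Type*} [Fintype ι] {d : ℕ}
    (ξ : Ext (ModuleCat.of R X) (ModuleCat.of R Y) d) (f : ι → Y →ₗ[R] Z) :
    extPush ξ (∑ j, f j) = ∑ j, extPush ξ (f j) := by
  have : ModuleCat.ofHom (∑ j, f j) = ∑ j, ModuleCat.ofHom (f j) := by
    apply ModuleCat.hom_ext
    simp [ModuleCat.hom_sum]
  rw [extPush, this, Ext.mk₀_sum, Ext.comp_sum]

lemma sum_extPush {ι : Type*} [Fintype ι] {d : ℕ}
    (ξ : ι → Ext (ModuleCat.of R X) (ModuleCat.of R Y) d) (f : Y →ₗ[R] Z) :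
    extPush (∑ j, ξ j) f = ∑ j, extPush (ξ j) f := Ext.sum_comp ..

lemma extPush_smul_id {d : ℕ} (ξ : Ext (ModuleCat.of R X) (ModuleCat.of R Y) d) (r : R) :
    extPush ξ (r • LinearMap.id) = r • ξ := by
  have : ModuleCat.ofHom (r • (LinearMap.id : Y →ₗ[R] Y)) = r • 𝟙 (ModuleCat.of R Y) := rfl
  rw [extPush, this, Ext.mk₀_smul, Ext.comp_smul, Ext.comp_mk₀_id]

lemma ext_eq_zero_of_sum {ι : Type*} [Fintype ι] (p : ι → Z →ₗ[R] Y) (s : ι → Y →ₗ[R] Z)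
    (h : ∑ j, s j ∘ₗ p j = LinearMap.id) {d : ℕ}
    (ξ : Ext (ModuleCat.of R X) (ModuleCat.of R Z) d) (hξ : ∀ j, extPush ξ (p j) = 0) :
    ξ = 0 := by
  rw [← extPush_id ξ, ← h, extPush_sum]
  refine Finset.sum_eq_zero fun j _ => ?_
  rw [← extPush_extPush, hξ, extPush_zero]

lemma ExtVanishes.pi {i : ℕ} (h : ExtVanishes R X Y i) (a : ℕ) :
    ExtVanishes R X (Fin a → Y) i := by
  rw [extVanishes_iff] at *
  intro ξ
  refine ext_eq_zero_of_sum (fun j => LinearMap.proj j) (fun j => LinearMap.single R (fun _ => Y) j) ?_ ξ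
    fun j => h _
  ext x l j
  simp [Pi.single_apply]

/-- The scalar multiples of a coordinate function. -/
abbrev coordMultiples {a : ℕ} (j : Fin a) : R →ₗ[R] Module.Dual R (Fin a → R) :=
  LinearMap.toSpanSingleton R _ (LinearMap.proj j)

lemma ext_dual_free_eq_zero {a d : ℕ}
    (ξ : Ext (ModuleCat.of R X) (ModuleCat.of R (Module.Dual R (Fin a → R))) d)
    (hξ : ∀ y, extPush ξ (Module.Dual.eval R (Fin a → R) y) = 0) : ξ = 0 := by
  refine ext_eq_zero_of_sum (fun j => Module.Dual.eval R (Fin a → R) (Pi.single j 1))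
    coordMultiples ?_ ξ fun j => hξ _
  ext φ j
  simp [Pi.single_apply]

lemma exists_ext_dual_free {a d : ℕ}
    (ψ : (Fin a → R) →ₗ[R] Ext (ModuleCat.of R X) (ModuleCat.of R R) d) :
    ∃ ξ : Ext (ModuleCat.of R X) (ModuleCat.of R (Module.Dual R (Fin a → R))) d,
      ∀ y, extPush ξ (Module.Dual.eval R (Fin a → R) y) = ψ y := by
  refine ⟨∑ j, extPush (ψ (Pi.single j 1)) (coordMultiples j), fun y => ?_⟩
  have h : ∀ j, Module.Dual.eval R (Fin a → R) y ∘ₗ coordMultiples j = y j • LinearMap.id := by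
    intro j
    ext
    simp
  simp_rw [sum_extPush, extPush_extPush, h, extPush_smul_id, ← map_smul, ← map_sum]
  congr 1
  ext l
  simp [Pi.single_apply]

lemma ExtVanishes.dual_free {a i : ℕ} (h : ExtVanishes R X R i) :
    ExtVanishes R X (Module.Dual R (Fin a → R)) i := by
  rw [extVanishes_iff] at *
  exact fun ξ => ext_dual_free_eq_zero ξ fun y => h _

lemma exact_dualMap {f : A →ₗ[R] B} {g : B →ₗ[R] Y} (hg : Function.Surjective g)
    (h : Function.Exact f g) : Function.Exact g.dualMap f.dualMap := by
  intro φ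
  constructor
  · intro hφ
    obtain ⟨ψ, hψ⟩ := h.exists_lift hg φ hφ
    exact ⟨ψ, hψ⟩
  · rintro ⟨ψ, rfl⟩
    ext x
    simp [h.apply_apply_eq_zero]

/-- A finitely generated module without higher extensions by the ring. -/
structure ExtAcyclic (R : Type u) [CommRing R] (Y : Type u) [AddCommGroup Y] [Module R Y] :
    Prop where
  finite : Module.Finite R Y
  ext_vanishes : ∀ i, 1 ≤ i → ExtVanishes R Y R i

/-- The syzygy is again acyclic and the dual sequence `0 → Y* → F* → K* → 0` is exact, which makes
dimension shifting in the second variable possible. -/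
lemma ExtAcyclic.exists_cover [IsNoetherianRing R] (hY : ExtAcyclic R Y) :
    ∃ (a : ℕ) (g : (Fin a → R) →ₗ[R] Y), Function.Surjective g ∧
      ExtAcyclic R (LinearMap.ker g) ∧
      Function.Surjective (LinearMap.ker g).subtype.dualMap := by
  have := hY.finite
  obtain ⟨a, g, hg⟩ := Module.Finite.exists_fin' R Y
  refine ⟨a, g, hg, ⟨inferInstance, fun i hi => ?_⟩, fun φ => ?_⟩
  · exact .contra_one (Submodule.subtype_injective _) hg (exact_ker_subtype g)
      (extVanishes_of_projective i hi) (hY.ext_vanishes _ (by omega))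
  · exact (hY.ext_vanishes 1 le_rfl).exists_extension (Submodule.subtype_injective _) hg
      (exact_ker_subtype g) φ

lemma ExtAcyclic.ext_dual_vanishes [IsNoetherianRing R] {i : ℕ}
    (hX : ∀ j, j ≤ i → ExtVanishes R X R j) (hY : ExtAcyclic R Y) :
    ExtVanishes R X (Module.Dual R Y) i := by
  induction i generalizing Y with
  | zero =>
    obtain ⟨a, g, hg, -⟩ := hY.exists_cover
    exact .zero_of_injective (LinearMap.dualMap_injective_of_surjective hg)
      (ExtVanishes.dual_free (hX 0 le_rfl))
  | succ i ih =>
    obtain ⟨a, g, hg, hK, hs⟩ := hY.exists_cover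
    exact .cov_one (LinearMap.dualMap_injective_of_surjective hg) hs
      (exact_dualMap hg (exact_ker_subtype g)) (ih (fun j hj => hX j (by omega)) hK)
      (ExtVanishes.dual_free (hX _ le_rfl))

/-- Injectivity of `Ext^d(X, Y*) → Hom(Y, Ext^d(X, R))`: a class that dies in `Ext^d(X, F*)` comes
from `Ext^{d-1}(X, K*)`, which vanishes. -/
lemma ExtAcyclic.ext_dual_eq_zero [IsNoetherianRing R] {d : ℕ}
    (hX : ∀ j, j < d → ExtVanishes R X R j) (hY : ExtAcyclic R Y)
    (ξ : Ext (ModuleCat.of R X) (ModuleCat.of R (Module.Dual R Y)) d)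
    (hξ : ∀ y, extPush ξ (Module.Dual.eval R Y y) = 0) : ξ = 0 := by
  obtain ⟨a, g, hg, hK, hs⟩ := hY.exists_cover
  have h0 : extPush ξ g.dualMap = 0 := by
    refine ext_dual_free_eq_zero _ fun y => ?_
    rw [extPush_extPush]
    exact hξ (g y)
  have hinj := LinearMap.dualMap_injective_of_surjective hg
  cases d with
  | zero =>
    have : Mono (ModuleCat.ofHom g.dualMap) := (ModuleCat.mono_iff_injective _).2 hinj
    exact Ext.postcomp_mk₀_injective_of_mono (ModuleCat.of R X) (ModuleCat.ofHom g.dualMap)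
      (h0.trans (extPush_zero g.dualMap).symm)
  | succ d =>
    obtain ⟨η, rfl⟩ := Ext.covariant_sequence_exact₁ (ModuleCat.of R X)
      (linearShortComplex_shortExact hinj hs (exact_dualMap hg (exact_ker_subtype g))) ξ h0 rfl
    rw [extVanishes_iff.1 (hK.ext_dual_vanishes (fun j hj => hX j (by omega))) η, Ext.zero_comp]

/-- Surjectivity of the same map: a homomorphism on `Y` is pulled back to the free cover, where a
class exists by hand. Its image in `Ext^d(X, K*)` is zero by the injectivity just shown, so the
class lifts. -/
lemma ExtAcyclic.exists_ext_dual [IsNoetherianRing R] {d : ℕ}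
    (hX : ∀ j, j < d → ExtVanishes R X R j) (hY : ExtAcyclic R Y)
    (ψ : Y →ₗ[R] Ext (ModuleCat.of R X) (ModuleCat.of R R) d) :
    ∃ ξ : Ext (ModuleCat.of R X) (ModuleCat.of R (Module.Dual R Y)) d,
      ∀ y, extPush ξ (Module.Dual.eval R Y y) = ψ y := by
  obtain ⟨a, g, hg, hK, hs⟩ := hY.exists_cover
  obtain ⟨η, hη⟩ := exists_ext_dual_free (ψ ∘ₗ g)
  have h0 : extPush η (LinearMap.ker g).subtype.dualMap = 0 := by
    refine hK.ext_dual_eq_zero hX _ fun y => ?_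
    rw [extPush_extPush]
    refine (hη y).trans ?_
    simp
  obtain ⟨ξ, hξ⟩ := Ext.covariant_sequence_exact₂ (ModuleCat.of R X)
    (linearShortComplex_shortExact (LinearMap.dualMap_injective_of_surjective hg) hs
      (exact_dualMap hg (exact_ker_subtype g))) η h0
  refine ⟨ξ, fun y => ?_⟩
  obtain ⟨x, rfl⟩ := hg y
  refine Eq.trans ?_ (hη x)
  rw [← hξ]
  exact (extPush_extPush ξ g.dualMap (Module.Dual.eval R (Fin a → R) x)).symm

end ExtIntoDuals

/-! ### Detecting surjectivity by Ext from the residue field. -/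

section Local

variable {R : Type u} [CommRing R] [IsLocalRing R] {Y Y' K X T : Type u}
  [AddCommGroup Y] [Module R Y] [AddCommGroup Y'] [Module R Y'] [AddCommGroup K] [Module R K]
  [AddCommGroup X] [Module R X] [AddCommGroup T] [Module R T]

lemma exists_map_to_residueField [Module.Finite R Y] [Nontrivial Y] :
    ∃ (φ : Y →ₗ[R] ResidueField R) (y : Y), φ y = 1 := by
  obtain ⟨N, hN, -⟩ := (eq_top_or_exists_le_coatom (⊥ : Submodule R Y)).resolve_left bot_ne_top
  have : IsSimpleModule R (Y ⧸ N) := isSimpleModule_iff_isCoatom.2 hN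
  obtain ⟨I, hI, ⟨e⟩⟩ := isSimpleModule_iff_quot_maximal.1 this
  obtain rfl := eq_maximalIdeal hI
  let φ : Y →ₗ[R] R ⧸ maximalIdeal R := e.toLinearMap ∘ₗ N.mkQ
  have hφ : Function.Surjective φ := e.surjective.comp N.mkQ_surjective
  obtain ⟨y, hy⟩ := hφ 1
  exact ⟨φ, y, hy⟩

/-- The maximal ideal acts on `Ext^d(k, Y)` through its zero action on `k`, so every class spans a
quotient of `k`. -/
lemma exists_map_from_residueField {d : ℕ}
    (e : Ext (ModuleCat.of R (ResidueField R)) (ModuleCat.of R Y) d) :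
    ∃ ψ : ResidueField R →ₗ[R]
      Ext (ModuleCat.of R (ResidueField R)) (ModuleCat.of R Y) d, ψ 1 = e := by
  refine ⟨Submodule.liftQ (maximalIdeal R) (LinearMap.toSpanSingleton R _ e) ?_, ?_⟩
  · intro r hr
    rw [LinearMap.mem_ker, LinearMap.toSpanSingleton_apply]
    have h0 : r • 𝟙 (ModuleCat.of R (ResidueField R)) = 0 := by
      ext x
      change r • x = 0
      rw [Algebra.smul_def, ResidueField.algebraMap_eq, (residue_eq_zero_iff r).2 hr, zero_mul]
    rw [← Ext.mk₀_id_comp e, ← Ext.smul_comp, ← Ext.mk₀_smul, h0, Ext.mk₀_zero, Ext.zero_comp]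
  · exact (Submodule.liftQ_apply _ _ (1 : R)).trans (by simp)

/-- A map of acyclic modules whose dual is injective on `Ext^d(k, -)`, where `d` is the depth of
the ring, is surjective. -/
lemma ExtAcyclic.surjective_of_ext_injective [IsNoetherianRing R] {d : ℕ}
    (hd : ∀ j, j < d → ExtVanishes R (ResidueField R) R j)
    (hd' : ¬ ExtVanishes R (ResidueField R) R d) (hY : ExtAcyclic R Y) (hY' : ExtAcyclic R Y')
    (v : Y →ₗ[R] Y')
    (hv : ∀ ξ : Ext (ModuleCat.of R (ResidueField R)) (ModuleCat.of R (Module.Dual R Y')) d,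
      extPush ξ v.dualMap = 0 → ξ = 0) : Function.Surjective v := by
  by_contra hs
  have := hY'.finite
  have : Nontrivial (Y' ⧸ LinearMap.range v) := by
    rw [Submodule.Quotient.nontrivial_iff]
    rwa [ne_eq, LinearMap.range_eq_top]
  -- If `v` is not onto, `Y' → coker v → k → Ext^d(k, R)` is a nonzero map that kills the image of
  -- `v`. It corresponds to a nonzero class in `Ext^d(k, Y'*)` whose image in `Ext^d(k, Y*)` is
  -- zero.
  obtain ⟨φ, z, hz⟩ := exists_map_to_residueField (R := R) (Y := Y' ⧸ LinearMap.range v)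
  obtain ⟨y, rfl⟩ := Submodule.mkQ_surjective _ z
  obtain ⟨e, he⟩ : ∃ e : Ext (ModuleCat.of R (ResidueField R)) (ModuleCat.of R R) d, e ≠ 0 := by
    by_contra! h
    exact hd' (extVanishes_iff.2 h)
  obtain ⟨ψ, hψ⟩ := exists_map_from_residueField e
  obtain ⟨ξ, hξ⟩ := hY'.exists_ext_dual hd (ψ ∘ₗ φ ∘ₗ (LinearMap.range v).mkQ)
  have h0 : extPush ξ v.dualMap = 0 := by
    refine hY.ext_dual_eq_zero hd _ fun x => ?_
    rw [extPush_extPush]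
    refine (hξ (v x)).trans ?_
    have hx : (LinearMap.range v).mkQ (v x) = 0 := by simp
    rw [LinearMap.comp_apply, LinearMap.comp_apply, hx, map_zero, map_zero]
  have h1 := hξ y
  rw [hv ξ h0, extPush_zero, LinearMap.comp_apply, LinearMap.comp_apply, hz, hψ] at h1
  exact he h1.symm

end Local

/-! ### Gorenstein dimension and the Auslander–Bridger bound. -/

section GorensteinDimension

variable {R : Type u} [CommRing R] {K X T A : Type u}
  [AddCommGroup K] [Module R K] [AddCommGroup X] [Module R X] [AddCommGroup T] [Module R T]
  [AddCommGroup A] [Module R A]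

lemma TotallyReflexive.extAcyclic_dual [IsNoetherianRing R] (h : TotallyReflexive R X) :
    ExtAcyclic R (Module.Dual R X) :=
  have := h.finite
  ⟨inferInstance, h.ext_dual_vanishes⟩

/-- Since `Ext¹(K, R) = 0`, dualizing gives an exact sequence `0 → K* → X* → A* → 0`; since
`Ext¹(A*, R) = 0`, it remains exact when dualized again. Comparison with the original sequence,
where `A` and `X` are reflexive, shows that `K` is reflexive. -/
lemma TotallyReflexive.of_exact {f : A →ₗ[R] X} {g : X →ₗ[R] K} (hf : Function.Injective f)
    (hg : Function.Surjective g) (h : Function.Exact f g) (hA : TotallyReflexive R A)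
    (hX : TotallyReflexive R X) (hK : ∀ i, 1 ≤ i → ExtVanishes R K R i) :
    TotallyReflexive R K := by
  have hs : Function.Surjective f.dualMap := fun φ =>
    (hK 1 le_rfl).exists_extension hf hg h φ
  have hg' := LinearMap.dualMap_injective_of_surjective hg
  have hd := exact_dualMap hg h
  have := hX.finite
  refine ⟨Module.Finite.of_surjective g hg, ⟨?_, ?_⟩, hK, fun i hi => ?_⟩
  · rw [injective_iff_map_eq_zero]
    intro m hm
    obtain ⟨x, rfl⟩ := hg m
    obtain ⟨τ, hτ⟩ := hd.exists_lift hs (Module.Dual.eval R X x) (by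
      ext φ
      exact LinearMap.congr_fun hm φ)
    obtain ⟨y, rfl⟩ := hA.bijective_eval.2 τ
    have : Module.Dual.eval R X x = Module.Dual.eval R X (f y) := by
      rw [← hτ]; rfl
    rw [hX.bijective_eval.1 this, h.apply_apply_eq_zero]
  · intro τ
    obtain ⟨σ, hσ⟩ := (hA.ext_dual_vanishes 1 le_rfl).exists_extension hg' hs hd τ
    obtain ⟨x, rfl⟩ := hX.bijective_eval.2 σ
    exact ⟨g x, by rw [← hσ]; rfl⟩
  · exact .contra_one hg' hs hd (hX.ext_dual_vanishes i hi) (hA.ext_dual_vanishes _ (by omega))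

/-- A module of finite Gorenstein dimension without higher extensions by the ring is totally
reflexive. -/
lemma HasTotallyReflexiveResolution.totallyReflexive {n : ℕ}
    (h : HasTotallyReflexiveResolution R n K) (hK : ∀ i, 1 ≤ i → ExtVanishes R K R i) :
    TotallyReflexive R K := by
  induction n generalizing K with
  | zero => exact h
  | succ n ih =>
    obtain ⟨X, _, _, g, hX, hg, hker⟩ := h
    have hA := ih hker fun i hi => .contra_one (Submodule.subtype_injective _) hg
      (exact_ker_subtype g) (hX.ext_vanishes i hi) (hK _ (by omega))
    exact .of_exact (Submodule.subtype_injective _) hg (exact_ker_subtype g) hA hX hK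

variable [IsLocalRing R] [IsNoetherianRing R]

/-- `X ≅ X**` is the dual of the acyclic module `X*`, so its Ext modules from `k` vanish wherever
those of `R` do up to that degree. -/
lemma TotallyReflexive.ext_residueField_vanishes {i : ℕ}
    (hd : ∀ j, j ≤ i → ExtVanishes R (ResidueField R) R j) (h : TotallyReflexive R X) :
    ExtVanishes R (ResidueField R) X i :=
  (h.extAcyclic_dual.ext_dual_vanishes hd).congr_right
    (LinearEquiv.ofBijective _ h.bijective_eval).symm

/-- If `G-dim T < ∞`, then `Ext^j(T, R) = 0` for `j > depth R - depth T`. -/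
lemma HasTotallyReflexiveResolution.ext_vanishes_of_depth {d : ℕ}
    (hd : ∀ j, j < d → ExtVanishes R (ResidueField R) R j)
    (hd' : ¬ ExtVanishes R (ResidueField R) R d) {n s : ℕ} (hs : s ≤ d)
    (h : HasTotallyReflexiveResolution R n T)
    (hT : ∀ j, j < s → ExtVanishes R (ResidueField R) T j) {j : ℕ} (hj : 1 ≤ j)
    (hjs : d < j + s) : ExtVanishes R T R j := by
  induction n generalizing T s j with
  | zero => exact TotallyReflexive.ext_vanishes h j hj
  | succ n ih =>
    obtain ⟨X, _, _, g, hX, hg, hker⟩ := h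
    have hi := Submodule.subtype_injective (LinearMap.ker g)
    have he := exact_ker_subtype g
    have hXd : ∀ j, j < d → ExtVanishes R (ResidueField R) X j := fun j hj =>
      hX.ext_residueField_vanishes fun l hl => hd l (by omega)
    have hKd : ∀ l, l < s + 1 → l < d → ExtVanishes R (ResidueField R) (LinearMap.ker g) l := by
      intro l hl hld
      cases l with
      | zero => exact .zero_of_injective hi (hXd 0 hld)
      | succ l => exact .cov_one hi hg he (hT l (by omega)) (hXd _ hld)
    obtain ⟨j, rfl⟩ : ∃ l, j = l + 1 := ⟨j - 1, by omega⟩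
    rcases Nat.eq_zero_or_pos j with rfl | hj'
    · obtain rfl : s = d := by omega
      have hK : TotallyReflexive R (LinearMap.ker g) := hker.totallyReflexive fun i hi =>
        ih le_rfl hker (fun l hl => hKd l (by omega) hl) hi (by omega)
      refine extVanishes_one_of_exists_extension hi hg he (hX.ext_vanishes 1 le_rfl) ?_
      refine ExtAcyclic.surjective_of_ext_injective hd hd' hX.extAcyclic_dual hK.extAcyclic_dual
        (LinearMap.ker g).subtype.dualMap fun ξ hξ => ?_
      let e := LinearEquiv.ofBijective _ hK.bijective_eval
      have hcomp : (LinearMap.ker g).subtype.dualMap.dualMap ∘ₗ e.toLinearMap =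
          Module.Dual.eval R X ∘ₗ (LinearMap.ker g).subtype := by
        ext x; rfl
      obtain ⟨eX, heX⟩ : ∃ eX : Module.Dual R (Module.Dual R X) →ₗ[R] X,
          eX ∘ₗ Module.Dual.eval R X = LinearMap.id :=
        ⟨(LinearEquiv.ofBijective _ hX.bijective_eval).symm.toLinearMap, by
          ext x
          exact (LinearEquiv.ofBijective _ hX.bijective_eval).symm_apply_apply x⟩
      have hξe : extPush (extPush ξ e.symm.toLinearMap) e.toLinearMap = ξ := by
        rw [extPush_extPush, show e.toLinearMap ∘ₗ e.symm.toLinearMap = LinearMap.id by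
          ext1 x; simp, extPush_id]
      have h0 : extPush (extPush ξ e.symm.toLinearMap) (LinearMap.ker g).subtype = 0 := by
        have : (LinearMap.ker g).subtype =
            eX ∘ₗ (LinearMap.ker g).subtype.dualMap.dualMap ∘ₗ e.toLinearMap := by
          rw [hcomp, ← LinearMap.comp_assoc, heX, LinearMap.id_comp]
        rw [this, ← extPush_extPush, ← extPush_extPush, hξe, hξ, extPush_zero]
      have hz : extPush ξ e.symm.toLinearMap = 0 := by
        cases s with
        | zero =>
          have : Mono (ModuleCat.ofHom (LinearMap.ker g).subtype) :=
            (ModuleCat.mono_iff_injective _).2 hi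
          exact Ext.postcomp_mk₀_injective_of_mono (ModuleCat.of R (ResidueField R))
            (ModuleCat.ofHom (LinearMap.ker g).subtype) (h0.trans (extPush_zero _).symm)
        | succ s =>
          obtain ⟨η, hη⟩ := Ext.covariant_sequence_exact₁ (ModuleCat.of R (ResidueField R))
            (linearShortComplex_shortExact hi hg he) (extPush ξ e.symm.toLinearMap) h0 rfl
          rw [← hη, extVanishes_iff.1 (hT s (by omega)) η, Ext.zero_comp]
      rw [← hξe, hz, extPush_zero]
    -- In higher degrees the claim is shifted to the kernel, for which one more Ext from `k`
    -- vanishes, unless `s` has already reached the cap `d`.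
    · rcases Nat.lt_or_ge s d with hsd | hsd
      · exact .contra_three hi hg he (ih (s := s + 1) hsd hker (fun l hl => hKd l hl (by omega))
          hj' (by omega)) (hX.ext_vanishes _ (by omega))
      · exact .contra_three hi hg he (ih (s := s) hs hker (fun l hl => hKd l (by omega)
          (by omega)) hj' (by omega)) (hX.ext_vanishes _ (by omega))

end GorensteinDimension

/-! ### Depth conditions at primes, and part (1). -/

section Depth

variable {R : Type u} [CommRing R]

lemma le_moduleDepth_iff [IsLocalRing R] {M : Type u} [AddCommGroup M] [Module R M] {c : ℕ∞} :
    c ≤ moduleDepth R M ↔ ∀ i : ℕ, ¬ ExtVanishes R (ResidueField R) M i → c ≤ i :=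
  le_iInf₂_iff

lemma exists_depth_of_moduleDepth_le [IsLocalRing R] {M : Type u} [AddCommGroup M] [Module R M]
    {n : ℕ} (h : moduleDepth R M ≤ n) :
    ∃ d ≤ n, (∀ j, j < d → ExtVanishes R (ResidueField R) M j) ∧
      ¬ ExtVanishes R (ResidueField R) M d := by
  classical
  have hex : ∃ d, ¬ ExtVanishes R (ResidueField R) M d := by
    by_contra! H
    have : ((n + 1 : ℕ) : ℕ∞) ≤ moduleDepth R M := le_moduleDepth_iff.2 fun i hi => (hi (H i)).elim
    have := this.trans h
    norm_cast at this
    omega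
  refine ⟨Nat.find hex, ?_, fun j hj => by simpa using Nat.find_min hex hj, Nat.find_spec hex⟩
  have : ((Nat.find hex : ℕ) : ℕ∞) ≤ moduleDepth R M := le_moduleDepth_iff.2 fun i hi => by
    exact_mod_cast Nat.find_min' hex hi
  exact_mod_cast this.trans h

/-- Modules of finite Gorenstein dimension have no extensions by the ring beyond its depth. -/
lemma HasTotallyReflexiveResolution.ext_vanishes_of_moduleDepth_lt [IsNoetherianRing R]
    [IsLocalRing R] {T : Type u} [AddCommGroup T] [Module R T] {n : ℕ}
    (h : HasTotallyReflexiveResolution R n T) {j : ℕ} (hj : moduleDepth R R < j) :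
    ExtVanishes R T R j := by
  obtain ⟨d, hd, h1, h2⟩ := exists_depth_of_moduleDepth_le hj.le
  have h3 : ((d : ℕ) : ℕ∞) ≤ moduleDepth R R := le_moduleDepth_iff.2 fun i hi => by
    by_contra! hlt
    exact hi (h1 i (by exact_mod_cast hlt))
  have h4 : d < j := by exact_mod_cast h3.trans_lt hj
  exact h.ext_vanishes_of_depth h1 h2 (Nat.zero_le d) (fun j hj => (Nat.not_lt_zero j hj).elim)
    (by omega) (by omega)

/-- An element with prime annihilator gives a socle element of the localization. -/
lemma not_extVanishes_zero_of_annihilator {M : Type u} [AddCommGroup M] [Module R M]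
    (p : Ideal R) [p.IsPrime] (m : M) (hm : ∀ r, r ∈ p ↔ r • m = 0) :
    LocalizedModule.mkLinearMap p.primeCompl M m ≠ 0 ∧
    ¬ ExtVanishes (Localization.AtPrime p) (ResidueField (Localization.AtPrime p))
      (LocalizedModule p.primeCompl M) 0 := by
  have h0 : LocalizedModule.mkLinearMap p.primeCompl M m ≠ 0 := by
    rw [ne_eq, IsLocalizedModule.eq_zero_iff p.primeCompl]
    rintro ⟨s, hs⟩
    exact s.2 ((hm s).2 hs)
  refine ⟨h0, fun h => ?_⟩
  rw [extVanishes_zero_iff] at h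
  let φ : ResidueField (Localization.AtPrime p) →ₗ[Localization.AtPrime p]
      LocalizedModule p.primeCompl M :=
    Submodule.liftQ (maximalIdeal (Localization.AtPrime p))
      (LinearMap.toSpanSingleton (Localization.AtPrime p) _
        (LocalizedModule.mkLinearMap p.primeCompl M m)) (by
      rw [← Localization.AtPrime.map_eq_maximalIdeal, Ideal.map, Submodule.span_le]
      rintro _ ⟨r, hr, rfl⟩
      change algebraMap R (Localization.AtPrime p) r •
        LocalizedModule.mkLinearMap p.primeCompl M m = 0
      rw [algebraMap_smul, ← map_smul, (hm r).1 hr, map_zero])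
  have h1 : φ (Submodule.Quotient.mk 1) = LocalizedModule.mkLinearMap p.primeCompl M m :=
    (Submodule.liftQ_apply _ _ _).trans (one_smul _ _)
  rw [h φ] at h1
  exact h0 h1.symm

/-- Localization commutes with finite powers of the ring. -/
def vecLocalizeEquiv (W : Submonoid R) (a : ℕ) :
    LocalizedModule W (Fin a → R) ≃ₗ[Localization W] (Fin a → Localization W) :=
  (IsLocalizedModule.linearEquiv W (LocalizedModule.mkLinearMap W (Fin a → R))
    (vecLocalize W a)).extendScalarsOfIsLocalization W (Localization W)

/-- `Ext¹(T, R)` embeds in `M`, so a nonzero one has an associated prime `p`, and the corresponding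
element is a socle element of `M_p`. It would give a nonzero class in `Ext¹(T_p, R_p)`. Only primes
with `depth M_p = 0` therefore need testing. -/
lemma ext_one_vanishes_of_localized [IsNoetherianRing R] {M T : Type u} [AddCommGroup M]
    [Module R M] [AddCommGroup T] [Module R T] (hMT : TransposePair R M T)
    (h : ∀ (p : Ideal R) [p.IsPrime],
      ¬ ExtVanishes (Localization.AtPrime p) (ResidueField (Localization.AtPrime p))
        (LocalizedModule p.primeCompl M) 0 →
      ExtVanishes (Localization.AtPrime p) (LocalizedModule p.primeCompl T)
        (Localization.AtPrime p) 1) : ExtVanishes R T R 1 := by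
  obtain ⟨a, b, B, ⟨g, hg, hBg⟩, hT⟩ := hMT
  obtain ⟨c, C, hCB⟩ := exists_matrixExact B
  rw [hT.ext_one_iff hCB, matrixExact_transpose hCB]
  intro x hx
  change x ∈ LinearMap.range Bᵀ.mulVecLin
  rw [← LinearMap.exact_iff.1 hBg, LinearMap.mem_ker]
  by_contra hne
  -- The copy of `ker Cᵀ / im Bᵀ = Ext¹(T, R)` inside `M`.
  let E : Submodule R M := (LinearMap.ker Cᵀ.mulVecLin).map g
  have : Nontrivial E := ⟨⟨g x, x, hx, rfl⟩, 0, fun h => hne (congrArg Subtype.val h)⟩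
  obtain ⟨p, hp⟩ := associatedPrimes.nonempty R E
  obtain ⟨hprime, e, he⟩ := isAssociatedPrime_iff.1 (AssociatedPrimes.mem_iff.1 hp)
  obtain ⟨_, y, hy, rfl⟩ := e
  have hm : ∀ r, r ∈ p ↔ r • g y = 0 := by
    intro r
    rw [he, Submodule.mem_colon_singleton, Submodule.mem_bot, Subtype.ext_iff]
    rfl
  obtain ⟨h0, h1⟩ := not_extVanishes_zero_of_annihilator p (g y) hm
  have h2 := h p h1
  rw [(hT.localize p.primeCompl).ext_one_iff (hCB.localize p.primeCompl)] at h2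
  obtain ⟨g', hg', hBg', hgg'⟩ := MatrixPresents.localize_aux p.primeCompl hg hBg
  apply h0
  rw [← hgg']
  refine (hBg' _).2 ((h2 _).1 ?_)
  have h3 := matLocalize_mulVecLin p.primeCompl Cᵀ
  have h4 := IsLocalizedModule.map_apply p.primeCompl (vecLocalize p.primeCompl b)
    (vecLocalize p.primeCompl c) Cᵀ.mulVecLin y
  rw [h3, LinearMap.mem_ker.1 hy, map_zero] at h4
  exact h4

/-- Induction along cosyzygies, where `s` counts the steps already made: `T` plays the role of an
`s`-th syzygy of the original transpose and `M` that of an `s`-th cosyzygy of the original module.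
Each step replaces `T` by `ΩT` and `M` by the cokernel of an embedding into a free module, which
exists because `Ext¹(T, R) = 0`; the depths of `M` may drop by one, and the hypotheses allow for
this. -/
theorem TransposePair.ext_vanishes_of_localized_depth [IsNoetherianRing R] (i : ℕ) :
    ∀ {s : ℕ} {M T : Type u} [AddCommGroup M] [Module R M] [AddCommGroup T] [Module R T],
    TransposePair R M T →
    (∀ (p : Ideal R) [p.IsPrime] (l : ℕ),
      ¬ ExtVanishes (Localization.AtPrime p) (ResidueField (Localization.AtPrime p))
        (LocalizedModule p.primeCompl M) l →
      min ((i + s : ℕ) : ℕ∞) (moduleDepth (Localization.AtPrime p) (Localization.AtPrime p)) ≤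
        ((l + s : ℕ) : ℕ∞)) →
    (∀ (p : Ideal R) [p.IsPrime] (j : ℕ), 1 ≤ j →
      moduleDepth (Localization.AtPrime p) (Localization.AtPrime p) < ((j + s : ℕ) : ℕ∞) →
      ExtVanishes (Localization.AtPrime p) (LocalizedModule p.primeCompl T)
        (Localization.AtPrime p) j) →
    ∀ j, 1 ≤ j → j ≤ i → ExtVanishes R T R j := by
  induction i with
  | zero => intro s M T _ _ _ _ _ _ _ j hj hj'; omega
  | succ i ih =>
    intro s M T _ _ _ _ hMT h1 h2 j hj hji
    have hE : ExtVanishes R T R 1 := by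
      refine ext_one_vanishes_of_localized hMT fun p _ hp => ?_
      -- With `l = 0` the minimum is at most `s`, and `i + 1 + s` is not, so `depth R_p ≤ s < 1 + s`
      -- and the bound on Ext of `T_p` applies in degree one.
      have h3 := h1 p 0 hp
      rw [min_le_iff] at h3
      refine h2 p 1 le_rfl ((h3.resolve_left ?_).trans_lt ?_)
      · norm_cast; omega
      · norm_cast; omega
    obtain rfl | ⟨j, rfl, hj'⟩ : j = 1 ∨ ∃ l, j = l + 1 ∧ 1 ≤ l := by
      rcases Nat.lt_or_ge 1 j with h | h
      · exact .inr ⟨j - 1, by omega, by omega⟩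
      · exact .inl (by omega)
    · exact hE
    obtain ⟨a, b, B, hM, hT⟩ := hMT
    obtain ⟨c, C, hCB⟩ := exists_matrixExact B
    have hT' := matrixPresents_range hCB
    have hM' := matrixPresents_quotient Cᵀ
    obtain ⟨f, g, -, hf, hg, hfg, -⟩ := hM'.exists_shortExact ((hT.ext_one_iff hCB).1 hE) hM
    rw [hT.ext_succ_iff hCB hT' hj']
    refine ih (s := s + 1) ⟨_, _, C, hM', hT'⟩ ?_ ?_ j hj' (by omega)
    · intro p _ l hl
      by_contra hlt
      rw [not_le, lt_min_iff] at hlt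
      apply hl
      refine .cov_three (linLocalize_injective p.primeCompl hf)
        (linLocalize_surjective p.primeCompl hg) (linLocalize_exact p.primeCompl hfg) ?_ ?_
      · refine ExtVanishes.congr_right (vecLocalizeEquiv p.primeCompl c).symm (ExtVanishes.pi ?_ c)
        by_contra hR
        have h3 := hlt.2.trans_le (le_moduleDepth_iff.1 le_rfl l hR)
        norm_cast at h3
        omega
      · by_contra hR
        have h3 := h1 p _ hR
        have h4 := lt_min hlt.1 hlt.2
        rw [show i + 1 + s = i + (s + 1) by omega, show l + 1 + s = l + (s + 1) by omega] at h3
        exact absurd h3 (not_le.2 h4)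
    · intro p _ j hj hlt
      have := h2 p (j + 1) (by omega) (by rwa [show j + 1 + s = j + (s + 1) by omega])
      rwa [(hT.localize p.primeCompl).ext_succ_iff (hCB.localize p.primeCompl)
        (hT'.localize p.primeCompl) hj] at this

lemma hasTotallyReflexiveResolution_of_gDim_lt_top {T : Type u} [AddCommGroup T] [Module R T]
    (h : gDim R T < ⊤) : ∃ n, HasTotallyReflexiveResolution R n T := by
  by_cases hT : Subsingleton T
  · exact ⟨0, totallyReflexive_of_projective⟩
  · rw [gDim, if_neg hT] at h
    by_contra! H
    simp [H] at h

lemma hasTotallyReflexiveResolution_of_gDim_le {T : Type u} [AddCommGroup T] [Module R T] {n : ℕ}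
    (h : gDim R T ≤ (n : WithBot ℕ∞)) : ∃ m ≤ n, HasTotallyReflexiveResolution R m T := by
  by_cases hT : Subsingleton T
  · exact ⟨0, Nat.zero_le n, totallyReflexive_of_projective⟩
  · rw [gDim, if_neg hT] at h
    by_contra! H
    have h1 : ((n + 1 : ℕ) : ℕ∞) ≤
        ⨅ (m : ℕ) (_ : HasTotallyReflexiveResolution R m T), (m : ℕ∞) := by
      refine le_iInf₂ fun m hm => ?_
      by_contra! hlt
      exact H m (by have : m < n + 1 := by exact_mod_cast hlt
                    omega) hm
    have h2 : (⨅ (m : ℕ) (_ : HasTotallyReflexiveResolution R m T), (m : ℕ∞)) ≤ (n : ℕ∞) := by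
      exact_mod_cast h
    have h3 := h1.trans h2
    norm_cast at h3
    omega

theorem TransposePair.ext_vanishes_of_satisfiesSTilde [IsNoetherianRing R] {M T : Type u}
    [AddCommGroup M] [Module R M] [AddCommGroup T] [Module R T] {r : ℕ}
    (hM : SatisfiesSTilde R M r) (hMT : TransposePair R M T) (hT : gDim R T < ⊤) (i : ℕ)
    (hi : 1 ≤ i) (hir : i ≤ r) : ExtVanishes R T R i := by
  obtain ⟨n, hn⟩ := hasTotallyReflexiveResolution_of_gDim_lt_top hT
  refine hMT.ext_vanishes_of_localized_depth (s := 0) r ?_ ?_ i hi hir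
  · intro p hp l hl
    have hp' : (⟨p, hp⟩ : PrimeSpectrum R) ∈ Module.support R M := by
      rw [Module.mem_support_iff]
      -- Outside the support the localization is zero and has infinite depth, so no condition arises
      -- there.
      by_contra hs
      rw [not_nontrivial_iff_subsingleton] at hs
      exact hl (ExtVanishes.of_subsingleton_right l)
    exact (hM _ hp').trans (le_moduleDepth_iff.1 le_rfl l hl)
  · intro p hp j hj hlt
    have : IsNoetherianRing (Localization.AtPrime p) :=
      IsLocalization.isNoetherianRing p.primeCompl _ inferInstance
    exact (hn.localize p.primeCompl).ext_vanishes_of_moduleDepth_lt hlt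

/-- Depth lemma: in the localized sequence the kernel gains one degree of depth over `M_p`, up to
the depth of `R_p`. -/
lemma SatisfiesSTilde.ker [Nontrivial R] {M P : Type u} [AddCommGroup M] [Module R M] [AddCommGroup P]
    [Module R P] [Module.Finite R P] [Module.Free R P] {r : ℕ} (hM : SatisfiesSTilde R M r)
    {g : P →ₗ[R] M} (hg : Function.Surjective g) :
    SatisfiesSTilde R (LinearMap.ker g) (r + 1) := by
  intro p hp
  rw [le_moduleDepth_iff]
  intro i hi
  by_contra hlt
  rw [not_le, lt_min_iff] at hlt
  have hR : ∀ l ≤ i, ExtVanishes (Localization.AtPrime p.asIdeal)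
      (ResidueField (Localization.AtPrime p.asIdeal))
      (LocalizedModule p.asIdeal.primeCompl P) l := by
    intro l hl
    let e := (Module.finBasis R P).equivFun
    have e' : (Fin (Module.finrank R P) → Localization p.asIdeal.primeCompl)
        ≃ₗ[Localization p.asIdeal.primeCompl] LocalizedModule p.asIdeal.primeCompl P :=
      (vecLocalizeEquiv p.asIdeal.primeCompl _).symm.trans
        (LinearEquiv.ofBijective (linLocalize p.asIdeal.primeCompl e.symm.toLinearMap)
          ⟨linLocalize_injective _ e.symm.injective, linLocalize_surjective _ e.symm.surjective⟩)
    refine ExtVanishes.congr_right e' (ExtVanishes.pi ?_ _)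
    by_contra hR
    have h3 := hlt.2.trans_le (le_moduleDepth_iff.1 le_rfl l hR)
    norm_cast at h3
    omega
  apply hi
  have hinj := linLocalize_injective p.asIdeal.primeCompl
    (Submodule.subtype_injective (LinearMap.ker g))
  cases i with
  | zero => exact .zero_of_injective hinj (hR 0 le_rfl)
  | succ i =>
    refine .cov_one hinj (linLocalize_surjective p.asIdeal.primeCompl hg)
      (linLocalize_exact p.asIdeal.primeCompl (exact_ker_subtype g)) ?_ (hR _ le_rfl)
    by_contra hM'
    by_cases hs : Subsingleton (LocalizedModule p.asIdeal.primeCompl M)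
    · exact hM' (ExtVanishes.of_subsingleton_right i)
    · rw [not_subsingleton_iff_nontrivial] at hs
      have h1 := (hM p (Module.mem_support_iff.2 hs)).trans (le_moduleDepth_iff.1 le_rfl i hM')
      rw [min_le_iff] at h1
      have h2 : i + 1 < r + 1 := by exact_mod_cast hlt.1
      rcases h1 with h1 | h1
      · have : r ≤ i := by exact_mod_cast h1
        omega
      · have h3 := hlt.2.trans_le h1
        norm_cast at h3
        omega

end Depth

/-! ### Diagram chases for tensor products with flat covers. -/

section TensorChase

variable {R : Type u} [CommRing R] {K F T L G N F₁ F₂ K' F' : Type u}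
  [AddCommGroup K] [Module R K] [AddCommGroup F] [Module R F] [AddCommGroup T] [Module R T]
  [AddCommGroup L] [Module R L] [AddCommGroup G] [Module R G] [AddCommGroup N] [Module R N]
  [AddCommGroup F₁] [Module R F₁] [AddCommGroup F₂] [Module R F₂]
  [AddCommGroup K'] [Module R K'] [AddCommGroup F'] [Module R F']

/-- Balancing of `Tor₁`: for short exact sequences `0 → K → F → T → 0` and `0 → L → G → N → 0`
with `F` flat, injectivity of `K ⊗ N → F ⊗ N` implies that of `T ⊗ L → T ⊗ G`. -/
lemma lTensor_injective_of_rTensor_injective [Module.Flat R F] {ι : K →ₗ[R] F} {π : F →ₗ[R] T}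
    (hπ : Function.Surjective π) (hιπ : Function.Exact ι π) {κ : L →ₗ[R] G} {ρ : G →ₗ[R] N}
    (hκ : Function.Injective κ) (hρ : Function.Surjective ρ) (hκρ : Function.Exact κ ρ)
    (h : Function.Injective (ι.rTensor N)) : Function.Injective (κ.lTensor T) := by
  rw [injective_iff_map_eq_zero]
  intro x hx
  obtain ⟨y, rfl⟩ := LinearMap.rTensor_surjective L hπ x
  have comm : ∀ {A B C D : Type u} [AddCommGroup A] [Module R A] [AddCommGroup B] [Module R B]
      [AddCommGroup C] [Module R C] [AddCommGroup D] [Module R D] (f : A →ₗ[R] B)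
      (g : C →ₗ[R] D) (w : A ⊗[R] C), g.lTensor B (f.rTensor C w) = f.rTensor D (g.lTensor A w) := by
    intro A B C D _ _ _ _ _ _ _ _ f g w
    rw [← LinearMap.comp_apply, ← LinearMap.comp_apply, LinearMap.lTensor_comp_rTensor,
      LinearMap.rTensor_comp_lTensor]
  rw [comm] at hx
  obtain ⟨z, hz⟩ := (rTensor_exact G hιπ hπ _).1 hx
  have h1 : ρ.lTensor K z = 0 := by
    apply h
    rw [← comm, hz, map_zero]
    exact (lTensor_exact F hκρ hρ).apply_apply_eq_zero y
  obtain ⟨w, rfl⟩ := (lTensor_exact K hκρ hρ z).1 h1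
  rw [← comm] at hz
  rw [← Module.Flat.lTensor_preserves_injective_linearMap (M := F) κ hκ hz]
  exact (rTensor_exact L hιπ hπ).apply_apply_eq_zero w

lemma lTensor_injective_iff_rTensor_injective [Module.Flat R F] [Module.Flat R G]
    {ι : K →ₗ[R] F} {π : F →ₗ[R] T} (hι : Function.Injective ι)
    (hπ : Function.Surjective π) (hιπ : Function.Exact ι π) {κ : L →ₗ[R] G} {ρ : G →ₗ[R] N}
    (hκ : Function.Injective κ) (hρ : Function.Surjective ρ) (hκρ : Function.Exact κ ρ) :
    Function.Injective (κ.lTensor T) ↔ Function.Injective (ι.lTensor N) := by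
  constructor
  · intro h
    rw [LinearMap.lTensor_inj_iff_rTensor_inj] at h
    exact lTensor_injective_of_rTensor_injective hρ hκρ hι hπ hιπ h
  · intro h
    rw [LinearMap.lTensor_inj_iff_rTensor_inj] at h
    exact lTensor_injective_of_rTensor_injective hπ hιπ hκ hρ hκρ h

/-- Both conditions say that `K ⊗ L → F ⊗ G` is injective. -/
lemma lTensor_kernel_injective_iff [Module.Flat R F] [Module.Flat R G]
    {ι : K →ₗ[R] F} (hι : Function.Injective ι) {κ : L →ₗ[R] G} (hκ : Function.Injective κ) :
    Function.Injective (κ.lTensor K) ↔ Function.Injective (ι.lTensor L) := by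
  rw [LinearMap.lTensor_inj_iff_rTensor_inj L ι]
  have h1 := Module.Flat.lTensor_preserves_injective_linearMap (M := F) κ hκ
  have h2 := Module.Flat.rTensor_preserves_injective_linearMap (M := G) ι hι
  have hc : ⇑(ι.rTensor G) ∘ ⇑(κ.lTensor K) = ⇑(κ.lTensor F) ∘ ⇑(ι.rTensor L) := by
    rw [← LinearMap.coe_comp, ← LinearMap.coe_comp, LinearMap.lTensor_comp_rTensor,
      LinearMap.rTensor_comp_lTensor]
  rw [← h2.of_comp_iff (κ.lTensor K), hc, h1.of_comp_iff]

/-- By right exactness the cokernel of `N ⊗ F₂ → N ⊗ F₁` is `N ⊗ im d₁`; the defect of exactness is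
the kernel of `N ⊗ im d₁ → N ⊗ F`. -/
lemma lTensor_exact_iff_range_injective {d₂ : F₂ →ₗ[R] F₁} {d₁ : F₁ →ₗ[R] F}
    (h : Function.Exact d₂ d₁) :
    Function.Exact (d₂.lTensor N) (d₁.lTensor N) ↔
      Function.Injective ((LinearMap.range d₁).subtype.lTensor N) := by
  have hs := LinearMap.surjective_rangeRestrict d₁
  have he : Function.Exact d₂ d₁.rangeRestrict := fun x => by
    rw [← h x, Subtype.ext_iff]; rfl
  have h1 := lTensor_exact N he hs
  have h2 := LinearMap.lTensor_surjective N hs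
  have h3 : d₁.lTensor N = (LinearMap.range d₁).subtype.lTensor N ∘ₗ d₁.rangeRestrict.lTensor N := by
    rw [← LinearMap.lTensor_comp]
    rfl
  constructor
  · intro H
    rw [injective_iff_map_eq_zero]
    intro x hx
    obtain ⟨y, rfl⟩ := h2 x
    obtain ⟨z, rfl⟩ := (H y).1 (by rw [h3]; exact hx)
    exact h1.apply_apply_eq_zero z
  · intro H y
    rw [← h1 y, h3, LinearMap.comp_apply]
    exact ⟨fun hy => H (hy.trans (map_zero _).symm), fun hy => by rw [hy, map_zero]⟩

end TensorChase

/-! ### Vanishing of `Tor₁` and `Tor₂` through flat covers. -/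

section TorCriteria

variable {R : Type u} [CommRing R] {K F T L G N K' F' : Type u}
  [AddCommGroup K] [Module R K] [AddCommGroup F] [Module R F] [AddCommGroup T] [Module R T]
  [AddCommGroup L] [Module R L] [AddCommGroup G] [Module R G] [AddCommGroup N] [Module R N]
  [AddCommGroup K'] [Module R K'] [AddCommGroup F'] [Module R F']

lemma torVanishes_iff_exact (P : ProjectiveResolution (ModuleCat.of R T)) (n : ℕ) :
    TorVanishes R N T (n + 1) ↔
      Function.Exact ((P.complex.d (n + 2) (n + 1)).hom.lTensor N)
        ((P.complex.d (n + 1) n).hom.lTensor N) := by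
  have e := P.isoLeftDerivedObj
    ((MonoidalCategory.tensoringLeft (ModuleCat.{u} R)).obj (ModuleCat.of R N)) (n + 1)
  refine (e.isZero_iff).trans ?_
  refine (HomologicalComplex.exactAt_iff_isZero_homology _ _).symm.trans ?_
  rw [HomologicalComplex.exactAt_iff' _ (n + 2) (n + 1) n (by simp) (by simp)]
  rw [ShortComplex.ShortExact.moduleCat_exact_iff_function_exact]
  rfl

lemma ProjectiveResolution.function_exact {T : ModuleCat.{u} R} (P : ProjectiveResolution T)
    (n : ℕ) : Function.Exact (P.complex.d (n + 2) (n + 1)).hom (P.complex.d (n + 1) n).hom :=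
  (ShortComplex.ShortExact.moduleCat_exact_iff_function_exact _).1 (P.exact_succ n)

lemma ProjectiveResolution.exists_augmentation (P : ProjectiveResolution (ModuleCat.of R T)) :
    ∃ π : P.complex.X 0 →ₗ[R] T, Function.Surjective π ∧
      Function.Exact (P.complex.d 1 0).hom π := by
  refine ⟨(P.π.f 0).hom, ?_, ?_⟩
  · exact (ModuleCat.epi_iff_surjective (P.π.f 0)).1 inferInstance
  · exact (ShortComplex.ShortExact.moduleCat_exact_iff_function_exact _).1 P.exact₀

lemma ProjectiveResolution.flat {T : ModuleCat.{u} R} (P : ProjectiveResolution T) (n : ℕ) :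
    Module.Flat R (P.complex.X n) := by
  have : Module.Projective R (P.complex.X n) := (IsProjective.iff_projective _).2 (P.projective n)
  infer_instance

lemma exists_flat_cover (R : Type u) [CommRing R] (N : Type u) [AddCommGroup N] [Module R N] :
    ∃ (G : Type u) (_ : AddCommGroup G) (_ : Module R G) (ρ : G →ₗ[R] N), Module.Flat R G ∧
      Function.Surjective ρ :=
  ⟨N →₀ R, _, _, Finsupp.linearCombination R id, inferInstance, fun n =>
    ⟨Finsupp.single n 1, by simp⟩⟩

lemma exact_range_subtype {A B C : Type u} [AddCommGroup A] [Module R A] [AddCommGroup B]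
    [Module R B] [AddCommGroup C] [Module R C] {f : A →ₗ[R] B} {g : B →ₗ[R] C}
    (h : Function.Exact f g) : Function.Exact (LinearMap.range f).subtype g := by
  intro x
  rw [h x]
  simp

/-- `Tor₁(N, T) = 0` through a flat cover of `T`. -/
lemma torVanishes_one_iff [Module.Flat R F] {ι : K →ₗ[R] F} {π : F →ₗ[R] T}
    (hι : Function.Injective ι) (hπ : Function.Surjective π) (hιπ : Function.Exact ι π) :
    TorVanishes R N T 1 ↔ Function.Injective (ι.lTensor N) := by
  let P := projectiveResolution (ModuleCat.of R T)
  obtain ⟨G, _, _, ρ, _, hρ⟩ := exists_flat_cover R N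
  obtain ⟨π', hπ', h0⟩ := ProjectiveResolution.exists_augmentation P
  have := ProjectiveResolution.flat P 0
  rw [torVanishes_iff_exact P 0,
    lTensor_exact_iff_range_injective (ProjectiveResolution.function_exact P 0),
    ← lTensor_injective_iff_rTensor_injective (Submodule.subtype_injective _) hπ'
      (exact_range_subtype h0) (Submodule.subtype_injective _) hρ (exact_ker_subtype ρ),
    ← lTensor_injective_iff_rTensor_injective hι hπ hιπ (Submodule.subtype_injective _) hρ
      (exact_ker_subtype ρ)]

/-- `Tor₁` is balanced, for vanishing. -/
lemma torVanishes_one_comm : TorVanishes R N T 1 ↔ TorVanishes R T N 1 := by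
  obtain ⟨G, _, _, ρ, _, hρ⟩ := exists_flat_cover R N
  obtain ⟨F, _, _, π, _, hπ⟩ := exists_flat_cover R T
  rw [torVanishes_one_iff (Submodule.subtype_injective _) hπ (exact_ker_subtype π),
    torVanishes_one_iff (Submodule.subtype_injective _) hρ (exact_ker_subtype ρ),
    lTensor_injective_iff_rTensor_injective (Submodule.subtype_injective _) hπ
      (exact_ker_subtype π) (Submodule.subtype_injective _) hρ (exact_ker_subtype ρ)]

/-- `Tor₂(N, T) = Tor₁(N, ΩT)`, for vanishing. -/
lemma torVanishes_two_iff [Module.Flat R F] {ι : K →ₗ[R] F} {π : F →ₗ[R] T}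
    (hι : Function.Injective ι) (hπ : Function.Surjective π) (hιπ : Function.Exact ι π) :
    TorVanishes R N T 2 ↔ TorVanishes R N K 1 := by
  let P := projectiveResolution (ModuleCat.of R T)
  obtain ⟨G, _, _, ρ, _, hρ⟩ := exists_flat_cover R N
  obtain ⟨π', hπ', h0⟩ := ProjectiveResolution.exists_augmentation P
  have := ProjectiveResolution.flat P 0
  have := ProjectiveResolution.flat P 1
  have he : Function.Exact (LinearMap.range (P.complex.d 2 1).hom).subtype
      (P.complex.d 1 0).hom.rangeRestrict := fun x => by
    rw [← exact_range_subtype (ProjectiveResolution.function_exact P 0) x, Subtype.ext_iff]; rfl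
  have hi := Submodule.subtype_injective (LinearMap.ker ρ)
  -- The chain passes through `Tor₁(ΩN, T)`, which does not depend on the cover of `T`: first it is
  -- reached from the projective resolution, then left through the given cover.
  rw [torVanishes_iff_exact P 1,
    lTensor_exact_iff_range_injective (ProjectiveResolution.function_exact P 1),
    ← lTensor_injective_iff_rTensor_injective (Submodule.subtype_injective _)
      (LinearMap.surjective_rangeRestrict _) he hi hρ (exact_ker_subtype ρ),
    lTensor_kernel_injective_iff (Submodule.subtype_injective _) hi,
    ← torVanishes_one_iff (Submodule.subtype_injective _) hπ' (exact_range_subtype h0),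
    torVanishes_one_iff hι hπ hιπ, ← lTensor_kernel_injective_iff hι hi,
    torVanishes_one_comm, torVanishes_one_iff hi hρ (exact_ker_subtype ρ)]

end TorCriteria

/-! ### The exact sequence linking `Ext¹(Y, -)` to Tor of `Tr ΩY`. -/

section TransposeTor

variable {R : Type u} [CommRing R] {Y P T N : Type u} [AddCommGroup Y] [Module R Y]
  [AddCommGroup P] [Module R P] [AddCommGroup T] [Module R T] [AddCommGroup N] [Module R N]
  {a b p : ℕ}

lemma piScalarRight_lTensor_mulVecLin (B : Matrix (Fin a) (Fin b) R) (t : N ⊗[R] (Fin b → R))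
    (i : Fin a) :
    TensorProduct.piScalarRight R R N (Fin a) (B.mulVecLin.lTensor N t) i =
      ∑ j, B i j • TensorProduct.piScalarRight R R N (Fin b) t j := by
  induction t with
  | zero => simp
  | add x y hx hy => simp only [map_add, Pi.add_apply, hx, hy, smul_add, Finset.sum_add_distrib]
  | tmul n v => simp [Matrix.mulVec, dotProduct, Finset.sum_smul, mul_smul]

/-- If `Ext¹(Y, N) = 0`, then every solution in `N` of the equations of the dual of `K = ker g` is
a combination of functionals on `K` that extend to `P`. -/
lemma exists_extending_combination {g : P →ₗ[R] Y} (hg : Function.Surjective g)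
    (bs : Module.Basis (Fin p) R P) (hY : ExtVanishes R Y N 1) {B : Matrix (Fin a) (Fin b) R}
    {h : (Fin b → R) →ₗ[R] LinearMap.ker g} (hh : Function.Surjective h)
    (hBh : Function.Exact Bᵀ.mulVecLin h) (t : N ⊗[R] (Fin b → R))
    (ht : B.mulVecLin.lTensor N t = 0) :
    ∃ y : Fin p → N, t = ∑ l, y l ⊗ₜ[R] fun j => bs.coord l (h (Pi.single j 1)) := by
  let x := TensorProduct.piScalarRight R R N (Fin b) t
  have hx : ∀ i, ∑ j, B i j • x j = 0 := by
    intro i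
    rw [← piScalarRight_lTensor_mulVecLin, ht, map_zero, Pi.zero_apply]
  obtain ⟨φ, hφ⟩ := hBh.exists_lift hh (Fintype.linearCombination R x) (by
    ext i
    simpa [Fintype.linearCombination_apply] using hx i)
  obtain ⟨ψ, hψ⟩ := hY.exists_extension (Submodule.subtype_injective _) hg
    (exact_ker_subtype g) φ
  refine ⟨fun l => ψ (bs l), (TensorProduct.piScalarRight R R N (Fin b)).injective ?_⟩
  ext j
  have h1 : x j = ψ (h (Pi.single j 1)) := by
    have h2 := LinearMap.congr_fun hφ (Pi.single j 1)
    rw [← hψ] at h2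
    simpa [Fintype.linearCombination_apply, Pi.single_apply] using h2.symm
  change x j = _
  rw [h1, map_sum, Finset.sum_apply]
  have h2 := congrArg ψ (bs.sum_repr (h (Pi.single j 1) : P))
  simp_rw [map_sum, map_smul] at h2
  rw [← h2]
  simp

/-- An element of `Tor₁(N, T)` lifts to a vector over `N` killed by `B`, which is a homomorphism `ΩY
→ N`. It extends to `P`, hence is a combination of restricted coordinate functionals; these lie in
`ker B` and so contribute nothing to `N ⊗ im B`. -/
lemma tor_one_vanishes_of_ext_one_vanishes {g : P →ₗ[R] Y} (hg : Function.Surjective g)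
    (bs : Module.Basis (Fin p) R P) (hY : ExtVanishes R Y N 1)
    (hT : TransposePair R (LinearMap.ker g) T) : TorVanishes R N T 1 := by
  obtain ⟨a, b, B, ⟨h, hh, hBh⟩, q, hq, hBq⟩ := hT
  rw [torVanishes_one_iff (Submodule.subtype_injective _) hq (exact_range_subtype hBq),
    injective_iff_map_eq_zero]
  intro s hs
  obtain ⟨t, rfl⟩ := LinearMap.lTensor_surjective N (LinearMap.surjective_rangeRestrict B.mulVecLin) s
  rw [← LinearMap.comp_apply, ← LinearMap.lTensor_comp] at hs
  obtain ⟨y, rfl⟩ := exists_extending_combination hg bs hY hh hBh t hs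
  rw [map_sum]
  refine Finset.sum_eq_zero fun l _ => ?_
  rw [LinearMap.lTensor_tmul]
  suffices B.mulVecLin.rangeRestrict (fun j => bs.coord l (h (Pi.single j 1))) = 0 by
    rw [this, tmul_zero]
  rw [Subtype.ext_iff]
  have hv : vecFunctional (fun j => bs.coord l (h (Pi.single j 1))) =
      bs.coord l ∘ₗ (LinearMap.ker g).subtype ∘ₗ h := by
    apply (Pi.basisFun R (Fin b)).ext
    intro i
    simp [vecFunctional_apply]
  have := (vecFunctional_comp_eq_zero_iff (fun j => bs.coord l (h (Pi.single j 1))) Bᵀ).1 (by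
    rw [hv, LinearMap.comp_assoc, LinearMap.comp_assoc, hBh.linearMap_comp_eq_zero,
      LinearMap.comp_zero, LinearMap.comp_zero])
  rwa [transpose_transpose] at this

/-- `N` surjects onto `k`, so `k ⊗ E = 0` and Nakayama applies. -/
lemma subsingleton_of_subsingleton_tensorProduct [IsLocalRing R] [Module.Finite R N]
    [Nontrivial N] {E : Type u} [AddCommGroup E] [Module R E] [Module.Finite R E]
    (h : Subsingleton (N ⊗[R] E)) : Subsingleton E := by
  obtain ⟨φ, y, hy⟩ := exists_map_to_residueField (R := R) (Y := N)
  have hφ : Function.Surjective φ := by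
    intro c
    obtain ⟨r, rfl⟩ := residue_surjective c
    refine ⟨r • y, ?_⟩
    rw [map_smul, hy, Algebra.smul_def, mul_one]
    rfl
  rw [← subsingleton_tensorProduct (R := R)]
  exact (LinearMap.rTensor_surjective E hφ).subsingleton

/-- `Ext¹(Y, R)` is the cokernel of `P* → (ΩY)* = ker B`. Vanishing of `Tor₂(N, T) = Tor₁(N, im B)`
makes `N ⊗ ker B` a submodule of `N ⊗ R^b`, where every element comes from `N ⊗ P*`. The cokernel
thus vanishes after tensoring with `N`, and Nakayama finishes. -/
lemma ext_one_ring_vanishes_of_tor_two_vanishes [IsNoetherianRing R] [IsLocalRing R]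
    [Module.Finite R N] [Nontrivial N] {g : P →ₗ[R] Y} (hg : Function.Surjective g)
    (bs : Module.Basis (Fin p) R P) (hY : ExtVanishes R Y N 1)
    (hT : TransposePair R (LinearMap.ker g) T) (hTor : TorVanishes R N T 2) :
    ExtVanishes R Y R 1 := by
  obtain ⟨a, b, B, ⟨h, hh, hBh⟩, q, hq, hBq⟩ := hT
  rw [torVanishes_two_iff (Submodule.subtype_injective _) hq (exact_range_subtype hBq)] at hTor
  have he : Function.Exact (LinearMap.ker B.mulVecLin).subtype B.mulVecLin.rangeRestrict :=
    fun x => by rw [← exact_ker_subtype B.mulVecLin x, Subtype.ext_iff]; rfl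
  rw [torVanishes_one_iff (Submodule.subtype_injective _)
    (LinearMap.surjective_rangeRestrict _) he] at hTor
  let vec : Module.Dual R P →ₗ[R] (Fin b → R) :=
    { toFun := fun φ j => φ (h (Pi.single j 1))
      map_add' := fun _ _ => rfl
      map_smul' := fun _ _ => rfl }
  have hvec : ∀ φ, vecFunctional (vec φ) = φ ∘ₗ (LinearMap.ker g).subtype ∘ₗ h := by
    intro φ
    apply (Pi.basisFun R (Fin b)).ext
    intro i
    simp [vecFunctional_apply, vec]
  have hker : ∀ φ, vec φ ∈ LinearMap.ker B.mulVecLin := by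
    intro φ
    have := (vecFunctional_comp_eq_zero_iff (vec φ) Bᵀ).1 (by
      rw [hvec, LinearMap.comp_assoc, LinearMap.comp_assoc, hBh.linearMap_comp_eq_zero,
        LinearMap.comp_zero, LinearMap.comp_zero])
    rwa [transpose_transpose] at this
  -- Restriction of functionals from `P` to `ΩY`, with `(ΩY)*` realized as `ker B`.
  let D : Module.Dual R P →ₗ[R] LinearMap.ker B.mulVecLin := LinearMap.codRestrict _ vec hker
  have hD : Function.Surjective D := by
    rw [← LinearMap.range_eq_top, ← Submodule.Quotient.subsingleton_iff]
    refine subsingleton_of_subsingleton_tensorProduct (R := R) (N := N) ?_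
    rw [subsingleton_iff_forall_eq 0]
    intro s
    obtain ⟨s, rfl⟩ := LinearMap.lTensor_surjective N
      (Submodule.mkQ_surjective (LinearMap.range D)) s
    obtain ⟨y, hy⟩ := exists_extending_combination hg bs hY hh hBh
      ((LinearMap.ker B.mulVecLin).subtype.lTensor N s) (by
        rw [← LinearMap.comp_apply, ← LinearMap.lTensor_comp, LinearMap.comp_ker_subtype,
          LinearMap.lTensor_zero, LinearMap.zero_apply])
    have hs : s = ∑ l, y l ⊗ₜ[R] D (bs.coord l) := by
      apply hTor
      rw [hy, map_sum]
      rfl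
    rw [hs, map_sum]
    refine Finset.sum_eq_zero fun l _ => ?_
    have h0 : (LinearMap.range D).mkQ (D (bs.coord l)) = 0 := by simp
    rw [LinearMap.lTensor_tmul, h0, tmul_zero]
  have : Module.Projective R P := Module.Projective.of_basis bs
  refine extVanishes_one_of_exists_extension (Submodule.subtype_injective _) hg
    (exact_ker_subtype g) (extVanishes_of_projective 1 le_rfl) fun φ => ?_
  obtain ⟨v, hv⟩ := exists_vecFunctional (φ ∘ₗ h)
  have hv0 := (vecFunctional_comp_eq_zero_iff v Bᵀ).1 (by
    rw [← hv, LinearMap.comp_assoc, hBh.linearMap_comp_eq_zero, LinearMap.comp_zero])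
  rw [transpose_transpose] at hv0
  obtain ⟨ψ, hψ⟩ := hD ⟨v, hv0⟩
  refine ⟨ψ, ?_⟩
  rw [← LinearMap.cancel_right hh, LinearMap.comp_assoc, ← hvec, hv]
  exact congrArg (fun z => vecFunctional z.1) hψ

end TransposeTor

/-! ### Projective dimension as a homological dimension. -/

section ProjectiveDimension

variable {R : Type u} [CommRing R] {M T P : Type u} [AddCommGroup M] [Module R M]
  [AddCommGroup T] [Module R T] [AddCommGroup P] [Module R P]

lemma pDim_le_iff {n : ℕ} : pDim R M ≤ ((n : ℕ) : WithBot ℕ∞) ↔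
    HasProjectiveDimensionLE (ModuleCat.of R M) n :=
  projectiveDimension_le_iff _ n

lemma pDim_le_zero_iff : pDim R M ≤ ((0 : ℕ) : WithBot ℕ∞) ↔ Module.Projective R M := by
  rw [pDim_le_iff, IsProjective.iff_projective]
  exact (projective_iff_hasProjectiveDimensionLE_zero _).symm

lemma pDim_eq_bot_iff : pDim R M = ⊥ ↔ Subsingleton M :=
  (projectiveDimension_eq_bot_iff _).trans ModuleCat.isZero_iff_subsingleton

lemma pDim_succ_le_iff [Module.Projective R P] {g : P →ₗ[R] M} (hg : Function.Surjective g)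
    (n : ℕ) : pDim R M ≤ ((n + 1 : ℕ) : WithBot ℕ∞) ↔
      pDim R (LinearMap.ker g) ≤ ((n : ℕ) : WithBot ℕ∞) := by
  rw [pDim_le_iff, pDim_le_iff]
  exact (LinearMap.shortExact_shortComplexKer hg).hasProjectiveDimensionLT_X₃_iff n
    ((IsProjective.iff_projective P).1 inferInstance)

lemma hasTotallyReflexiveResolution_of_pDim_le [IsNoetherianRing R] [Module.Finite R M] {n : ℕ}
    (h : pDim R M ≤ ((n : ℕ) : WithBot ℕ∞)) : HasTotallyReflexiveResolution R n M := by
  induction n generalizing M with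
  | zero =>
    have := pDim_le_zero_iff.1 h
    exact totallyReflexive_of_projective
  | succ n ih =>
    obtain ⟨a, g, hg⟩ := Module.Finite.exists_fin' R M
    exact ⟨Fin a → R, _, _, g, totallyReflexive_of_projective, hg,
      ih ((pDim_succ_le_iff hg n).1 h)⟩

lemma gDim_le_pDim [IsNoetherianRing R] [Module.Finite R M] : gDim R M ≤ pDim R M := by
  by_cases hM : Subsingleton M
  · rw [gDim, if_pos hM]
    exact bot_le
  · generalize hc : pDim R M = c
    induction c with
    | bot => exact (hM (pDim_eq_bot_iff.1 hc)).elim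
    | coe c =>
      induction c with
      | top => exact le_top
      | coe n =>
        rw [gDim, if_neg hM]
        have h := hasTotallyReflexiveResolution_of_pDim_le (M := M) (n := n) hc.le
        exact WithBot.coe_le_coe.2 (iInf₂_le n h)

variable (R) in
/-- The projective dimension as a homological dimension. -/
def projectiveHomologicalDimension [IsNoetherianRing R] [IsLocalRing R] :
    HomologicalDimension R where
  dim M := pDim R M
  dim_congr M M' _ _ _ _ _ e := ModuleCat.projectiveDimension_eq_of_linearEquiv e
  gDim_le M _ _ _ := gDim_le_pDim
  le_pDim M _ _ _ := le_rfl
  transpose M T _ _ _ _ _ hT h := by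
    by_cases hs : Subsingleton T
    · exact .inl hs
    · have := pDim_le_zero_iff.1 h.le
      have : Module.Projective R T := hT.transposePair.projective
      have : Projective (ModuleCat.of R T) := (IsProjective.iff_projective T).1 inferInstance
      have : Nontrivial (ModuleCat.of R T) := not_subsingleton_iff_nontrivial.1 hs
      exact .inr (ModuleCat.projectiveDimension_eq_zero_of_projective _)
  syzygy P M _ _ _ _ _ _ g hg n := pDim_succ_le_iff hg n

end ProjectiveDimension

/-! ### Homological dimensions of totally reflexive modules, and part (2). -/

section HomologicalDimensions

variable {R : Type u} [CommRing R] {Y M T P N : Type u} [AddCommGroup M]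
  [Module R M] [AddCommGroup T] [Module R T] [AddCommGroup Y] [Module R Y] [AddCommGroup P]
  [Module R P] [AddCommGroup N] [Module R N]

lemma HomologicalDimension.dim_le_zero_of_projective (H : HomologicalDimension R)
    [Module.Finite R M] [Module.Projective R M] : H.dim M ≤ ((0 : ℕ) : WithBot ℕ∞) :=
  (H.le_pDim M).trans (pDim_le_zero_iff.2 inferInstance)

lemma HomologicalDimension.dim_le_zero_of_transposePair (H : HomologicalDimension R)
    (hMT : TransposePair R M T) (hM : H.dim M ≤ ((0 : ℕ) : WithBot ℕ∞)) :
    H.dim T ≤ ((0 : ℕ) : WithBot ℕ∞) := by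
  have hfin : Module.Finite R M ∧ Module.Finite R T := by
    obtain ⟨a, b, B, h1, h2⟩ := hMT
    exact ⟨h1.finite, h2.finite⟩
  obtain ⟨_, _⟩ := hfin
  by_cases hs : Subsingleton M
  · have : Module.Projective R M := Module.Projective.of_free
    have := hMT.projective
    exact H.dim_le_zero_of_projective
  -- For nonzero `M` the G-dimension is nonnegative, which turns the upper bound into the equality
  -- required by the transpose axiom.
  · have h0 : H.dim M = 0 := by
      refine le_antisymm hM ?_
      refine le_trans ?_ (H.gDim_le M)
      rw [gDim, if_neg hs]
      exact WithBot.coe_le_coe.2 zero_le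
    rcases H.transpose M T hMT.isTranspose h0 with h | h
    · have : Module.Projective R T := Module.Projective.of_free
      exact H.dim_le_zero_of_projective
    · exact h.le

/-- A totally reflexive module of finite homological dimension has homological dimension at most
zero. -/
lemma HomologicalDimension.dim_le_zero_of_totallyReflexive [IsNoetherianRing R]
    (H : HomologicalDimension R) {m : ℕ} (hY : TotallyReflexive R Y)
    (hm : H.dim Y ≤ ((m : ℕ) : WithBot ℕ∞)) : H.dim Y ≤ ((0 : ℕ) : WithBot ℕ∞) := by
  induction m generalizing Y with
  | zero => exact hm
  | succ m ih =>
    have := hY.finite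
    obtain ⟨a, b, B, hB⟩ := exists_matrixPresents R Y
    obtain ⟨c, C, hCB⟩ := exists_matrixExact B
    have hY' := matrixPresents_range hCB
    have hX := matrixPresents_quotient Bᵀ
    have hX' := matrixPresents_quotient Cᵀ
    have pair : TransposePair R ((Fin b → R) ⧸ LinearMap.range Bᵀ.mulVecLin) Y :=
      ⟨_, _, B, hX, hB⟩
    have pair' : TransposePair R (LinearMap.range B.mulVecLin)
      ((Fin c → R) ⧸ LinearMap.range Cᵀ.mulVecLin) := ⟨_, _, Cᵀ, hY', hX'⟩
    have hExt := (pair.symm.totallyReflexive_iff.1 hY).2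
    -- The syzygy axiom alone never descends from dimension one to dimension zero. The detour is
    -- through transposes: since `Ext¹(Y, R) = 0`, `Tr Y` is a syzygy of `Tr ΩY`. Dimension at most
    -- zero thus travels from `ΩY` to `Tr ΩY`, then to its syzygy `Tr Y`, and finally to `Y`.
    have hBC : MatrixExact Bᵀ Cᵀ := (hB.ext_one_iff hCB).1 (hY.ext_vanishes 1 le_rfl)
    have hTR : TotallyReflexive R (LinearMap.range B.mulVecLin) := by
      refine pair'.totallyReflexive_iff.2 ⟨fun i hi => ?_, fun i hi => ?_⟩
      · exact (hB.ext_succ_iff hCB hY' hi).1 (hY.ext_vanishes _ (by omega))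
      · rcases Nat.lt_or_ge 1 i with h | h
        · obtain ⟨j, rfl⟩ : ∃ j, i = j + 1 := ⟨i - 1, by omega⟩
          exact (hX'.ext_succ_iff hBC hX (by omega)).2 (hExt j (by omega))
        · obtain rfl : i = 1 := by omega
          rw [hX'.ext_one_iff hBC, transpose_transpose, transpose_transpose]
          exact hCB
    obtain ⟨f, g, -, hf, hg, hfg, -⟩ := hB.exists_shortExact hCB hY'
    obtain ⟨e⟩ := nonempty_equiv_ker hf hfg
    have h1 : H.dim (LinearMap.range B.mulVecLin) ≤ ((m : ℕ) : WithBot ℕ∞) := by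
      rw [H.dim_congr _ _ e]
      exact (H.syzygy _ _ g hg m).1 hm
    have h2 := H.dim_le_zero_of_transposePair pair' (ih hTR h1)
    obtain ⟨f', g', -, hf', hg', hfg', -⟩ := hX'.exists_shortExact hBC hX
    obtain ⟨e'⟩ := nonempty_equiv_ker hf' hfg'
    have h3 := (H.syzygy _ _ g' hg' 0).1 (h2.trans (by exact_mod_cast Nat.zero_le 1))
    rw [← H.dim_congr _ _ e'] at h3
    exact H.dim_le_zero_of_transposePair pair h3

variable [IsNoetherianRing R] [IsLocalRing R]

/-- Total reflexivity and dimension at most zero pass from `T` to its transpose `ΩY`. Vanishing of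
`Tor₂` supplies the missing `Ext¹(Y, R) = 0`, so `Y` is totally reflexive; having dimension at most
one, it has dimension at most zero. -/
lemma HomologicalDimension.dim_le_zero_of_tor_two_vanishes (H : HomologicalDimension R)
    [Module.Finite R N] [Nontrivial N] [Module.Finite R P] [Module.Free R P] {g : P →ₗ[R] Y}
    (hg : Function.Surjective g) (hT : TransposePair R (LinearMap.ker g) T)
    (hY : ExtVanishes R Y N 1) (hTor : TorVanishes R N T 2)
    (hTR : TotallyReflexive R T) {m : ℕ} (hm : H.dim T ≤ ((m : ℕ) : WithBot ℕ∞)) :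
    H.dim Y ≤ ((0 : ℕ) : WithBot ℕ∞) := by
  have hK0 := H.dim_le_zero_of_transposePair hT.symm (H.dim_le_zero_of_totallyReflexive hTR hm)
  have hK : TotallyReflexive R (LinearMap.ker g) := by
    have := hT.symm.totallyReflexive_iff.1 hTR
    exact hT.totallyReflexive_iff.2 ⟨this.2, this.1⟩
  have hY1 := ext_one_ring_vanishes_of_tor_two_vanishes hg (Module.finBasis R P) hY hT hTor
  have hi := Submodule.subtype_injective (LinearMap.ker g)
  have he := exact_ker_subtype g
  have hYTR : TotallyReflexive R Y := by
    refine .of_exact hi hg he hK totallyReflexive_of_projective fun i hi' => ?_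
    rcases Nat.lt_or_ge 1 i with h | h
    · obtain ⟨j, rfl⟩ : ∃ j, i = j + 1 := ⟨i - 1, by omega⟩
      exact (ExtVanishes.succ_iff_of_projective hi hg he (by omega)).2
        (hK.ext_vanishes j (by omega))
    · obtain rfl : i = 1 := by omega
      exact hY1
  exact H.dim_le_zero_of_totallyReflexive hYTR ((H.syzygy P Y g hg 0).2 hK0)

lemma pDim_le_zero_of_stronglyRigid [Module.Finite R N] [Nontrivial N] [Module.Finite R Y] {r : ℕ}
    (hr : SatisfiesSTilde R Y r) (hY : ExtVanishes R Y N 1) (hN : StronglyRigid R N)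
    (hd : moduleDepth R R ≤ ((r + 1 : ℕ) : ℕ∞)) : pDim R Y ≤ ((0 : ℕ) : WithBot ℕ∞) := by
  obtain ⟨a, g, hg⟩ := Module.Finite.exists_fin' R Y
  obtain ⟨T, _, _, hT⟩ := exists_transposePair R (LinearMap.ker g)
  have : Module.Finite R T := by obtain ⟨_, _, _, -, h⟩ := hT; exact h.finite
  have hTor := tor_one_vanishes_of_ext_one_vanishes hg (Pi.basisFun R (Fin a)) hY hT
  have hp : pDim R T < ⊤ := hN T 1 le_rfl hTor
  obtain ⟨m, hm⟩ : ∃ m : ℕ, pDim R T ≤ ((m : ℕ) : WithBot ℕ∞) := by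
    obtain ⟨m, hm⟩ := (projectiveDimension_ne_top_iff (ModuleCat.of R T)).1 hp.ne
    exact ⟨m, pDim_le_iff.2 hm⟩
  have hres := hasTotallyReflexiveResolution_of_pDim_le hm
  have hTR : TotallyReflexive R T := by
    refine hres.totallyReflexive fun j hj => ?_
    -- Degrees above `r + 1` exceed `depth R`; the others are covered by part (1), because `ΩY`
    -- satisfies `(S̃_{r+1})`.
    rcases Nat.lt_or_ge (r + 1) j with h | h
    · exact hres.ext_vanishes_of_moduleDepth_lt (hd.trans_lt (by exact_mod_cast h))
    · exact hT.ext_vanishes_of_satisfiesSTilde (hr.ker hg) (gDim_le_pDim.trans_lt hp) j hj h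
  have hT0 : pDim R T ≤ ((0 : ℕ) : WithBot ℕ∞) :=
    (projectiveHomologicalDimension R).dim_le_zero_of_totallyReflexive hTR hm
  have := pDim_le_zero_iff.1 hT0
  have : Projective (ModuleCat.of R T) := (IsProjective.iff_projective T).1 inferInstance
  have hTor2 : TorVanishes R N T 2 := isZero_Tor_succ_of_projective _ _ _ 1
  exact (projectiveHomologicalDimension R).dim_le_zero_of_tor_two_vanishes hg hT hY hTor2 hTR hm

lemma HomologicalDimension.dim_le_zero_of_torRigid (H : HomologicalDimension R)
    [Module.Finite R N] [Nontrivial N] [Module.Finite R P] [Module.Free R P] {g : P →ₗ[R] Y}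
    (hg : Function.Surjective g) (hT : TransposePair R (LinearMap.ker g) T) {r : ℕ}
    (hr : SatisfiesSTilde R Y r) (hY : ExtVanishes R Y N 1) (hN : TorRigid R N)
    (hd : moduleDepth R N ≤ ((r + 1 : ℕ) : ℕ∞)) (hDF : DepthFormulaCondition R H T N) :
    H.dim Y ≤ ((0 : ℕ) : WithBot ℕ∞) := by
  have : Module.Finite R T := by obtain ⟨_, _, _, -, h⟩ := hT; exact h.finite
  have hTor := tor_one_vanishes_of_ext_one_vanishes hg (Module.finBasis R P) hY hT
  have hm : H.dim T ≤ ((r + 1 : ℕ) : WithBot ℕ∞) := by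
    by_cases hs : Subsingleton T
    · have : Module.Projective R T := Module.Projective.of_free
      exact H.dim_le_zero_of_projective.trans (by exact_mod_cast Nat.zero_le _)
    · have h := hDF (not_subsingleton_iff_nontrivial.1 hs) inferInstance
        (torVanishes_one_comm.1 hTor)
      -- Of the depth of `T ⊗ N` only its nonnegativity matters: the depth formula then gives `H-dim
      -- T ≤ depth N ≤ r + 1`.
      calc H.dim T ≤ H.dim T + ((moduleDepth R (T ⊗[R] N) : ℕ∞) : WithBot ℕ∞) :=
            le_add_of_nonneg_right (WithBot.coe_le_coe.2 zero_le)
        _ = ((moduleDepth R N : ℕ∞) : WithBot ℕ∞) := h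
        _ ≤ _ := WithBot.coe_le_coe.2 hd
  have hg' : gDim R T ≤ ((r + 1 : ℕ) : WithBot ℕ∞) := (H.gDim_le T).trans hm
  obtain ⟨n, hn, hres⟩ := hasTotallyReflexiveResolution_of_gDim_le hg'
  have hTR : TotallyReflexive R T := by
    refine hres.totallyReflexive fun j hj => ?_
    rcases Nat.lt_or_ge (r + 1) j with h | h
    · exact hres.ext_vanishes (by omega)
    · exact hT.ext_vanishes_of_satisfiesSTilde (hr.ker hg)
        (hg'.trans_lt (WithBot.coe_lt_coe.2 (ENat.natCast_lt_top _))) j hj h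
  exact H.dim_le_zero_of_tor_two_vanishes hg hT hY (hN T 1 le_rfl hTor) hTR hm

/-- Passing to a syzygy trades one unit of `n` for one unit of `r`, leaving the bound on the depth
unchanged. -/
theorem pDim_le_of_stronglyRigid [Module.Finite R N] [Nontrivial N] (hN : StronglyRigid R N)
    {n r : ℕ} [Module.Finite R M] (hr : SatisfiesSTilde R M r)
    (hM : ExtVanishes R M N (n + 1)) (hd : moduleDepth R R ≤ ((n + 1 + r : ℕ) : ℕ∞)) :
    pDim R M ≤ ((n : ℕ) : WithBot ℕ∞) := by
  induction n generalizing M r with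
  | zero => exact pDim_le_zero_of_stronglyRigid hr hM hN (by rwa [add_comm, zero_add] at hd)
  | succ n ih =>
    obtain ⟨a, g, hg⟩ := Module.Finite.exists_fin' R M
    rw [pDim_succ_le_iff hg]
    refine ih (hr.ker hg) ?_ (by rwa [show n + 1 + (r + 1) = n + 1 + 1 + r by omega])
    exact (ExtVanishes.succ_iff_of_projective (Submodule.subtype_injective _) hg
      (exact_ker_subtype g) (by omega)).1 hM

theorem HomologicalDimension.dim_le_of_torRigid (H : HomologicalDimension R)
    [Module.Finite R N] [Nontrivial N] (hN : TorRigid R N) (hDF : DepthFormulaCondition R H T N)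
    {n r : ℕ} (hr : SatisfiesSTilde R M r)
    (hM : ExtVanishes R M N (n + 1)) (hd : moduleDepth R N ≤ ((n + 1 + r : ℕ) : ℕ∞))
    (hT : IsTransposeOfSyzygy R (n + 1) M T) : H.dim M ≤ ((n : ℕ) : WithBot ℕ∞) := by
  induction n generalizing M r with
  | zero =>
    obtain ⟨K, _, _, ⟨P, _, _, g, _, _, hg, ⟨e⟩⟩, hKT⟩ := hT
    have : Module.Free R P := Module.free_of_flat_of_isLocalRing
    -- Each step of the induction consumes the first cover in the chosen chain of syzygies, so the
    -- same `T` serves throughout and is here a transpose of the first syzygy.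
    exact H.dim_le_zero_of_torRigid hg (hKT.transposePair.congr_left e) hr hM hN
      (by rwa [zero_add, add_comm] at hd) hDF
  | succ n ih =>
    obtain ⟨K, _, _, ⟨P, _, _, g, _, _, hg, hK⟩, hKT⟩ := hT
    have : Module.Free R P := Module.free_of_flat_of_isLocalRing
    refine (H.syzygy P M g hg n).2 (ih (hr.ker hg) ?_
      (by rwa [show n + 1 + (r + 1) = n + 1 + 1 + r by omega]) ⟨K, _, _, hK, hKT⟩)
    exact (ExtVanishes.succ_iff_of_projective (Submodule.subtype_injective _) hg
      (exact_ker_subtype g) (by omega)).1 hM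

end HomologicalDimensions

end

theorem theorem5 (R : Type u) [CommRing R] [IsNoetherianRing R] [IsLocalRing R]
    (M N : Type u) [AddCommGroup M] [Module R M] [Module.Finite R M] [Nontrivial M]
    [AddCommGroup N] [Module R N] [Module.Finite R N] [Nontrivial N]
    (r : ℕ) (hM : SatisfiesSTilde R M r) :
    (∀ (T : Type u) [AddCommGroup T] [Module R T], IsTranspose R M T → gDim R T < ⊤ →
      ∀ i : ℕ, 1 ≤ i → i ≤ r → ExtVanishes R T R i) ∧
    (∀ n : ℕ, 1 ≤ n → ExtVanishes R M N n →
      (StronglyRigid R N → moduleDepth R R ≤ ((n + r : ℕ) : ℕ∞) →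
        pDim R M ≤ ((n - 1 : ℕ) : WithBot ℕ∞)) ∧
      (∀ (H : HomologicalDimension R) (T : Type u) [AddCommGroup T] [Module R T],
        TorRigid R N → moduleDepth R N ≤ ((n + r : ℕ) : ℕ∞) →
        IsTransposeOfSyzygy R n M T → DepthFormulaCondition R H T N →
        H.dim M ≤ ((n - 1 : ℕ) : WithBot ℕ∞))) := by
  refine ⟨fun T _ _ hT hG i hi hir =>
    hT.transposePair.ext_vanishes_of_satisfiesSTilde hM hG i hi hir, fun n hn hExt => ?_⟩
  obtain ⟨m, rfl⟩ : ∃ m, n = m + 1 := ⟨n - 1, by omega⟩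
  exact ⟨fun hN hd => pDim_le_of_stronglyRigid hN hM hExt hd,
    fun H T _ _ hN hd hT hDF => H.dim_le_of_torRigid hN hDF hM hExt hd hT⟩
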